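/- Let $Z$ be a random vector in $\mathbb{R}^p$ with $E\|Z\|^2<\infty$ (for instance a standardized predictor, $E[Z]=0$, $\mathrm{var}(Z)=I$; standardization is not needed for the statement) and let $Y$ be a real random variable. A linear subspace $E\subset\mathbb{R}^p$ with orthogonal projection $P_E$ is a dimension reduction subspace if $Y$ and $Z$ are conditionally independent given $P_EZ$. Suppose that there is a unique dimension reduction subspace $E_c$ of minimal dimension (the central subspace), let $d=\dim E_c<p$, let $P_c$ be the orthogonal projection onto $E_c$ and $Q_c=I-P_c$. Assume (i) (linearity condition) $Q_c\,E[Z\mid P_cZ]=0$ a.s.; (ii) (diagonal conditional variance) $\mathrm{var}(Z\mid P_cZ)=\lambda^*_\omega Q_c$ a.s. for some real random variable $\lambda^*_\omega$. Let $\psi:\mathbb{R}\to\mathbb{R}$ be measurable with $E[\|Z\|^4\psi(Y)^2]<\infty$, and put $$M_\psi=E[ZZ^T\psi(Y)],\qquad \lambda^*_\psi=\frac{1}{p-d}E\big[\|Q_cZ\|^2\psi(Y)\big].$$ Assume that $\psi$ covers the central subspace: the column space of $M_\psi-\lambda^*_\psi I$ equals $E_c$. Let $(Z_i,Y_i)_{i\ge1}$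 be independent copies of $(Z,Y)$ and $\widehat M_\psi=\frac1n\sum_{i=1}^nZ_iZ_i^T\psi(Y_i)$. For a closed piecewise $C^1$ contour $\mathcal{C}$ in $\mathbb{C}$ which avoids the eigenvalues of $M_\psi$, has winding number $1$ around each eigenvalue of $M_\psi$ different from $\lambda^*_\psi$, and has winding number $0$ around $\lambda^*_\psi$, let $$\widehat P_n=\frac{1}{2\pi i}\oint_{\mathcal{C}}(zI-\widehat M_\psi)^{-1}\,dz .$$ Then $n\,\mathrm{tr}(Q_c\widehat P_n)$ converges in law, as $n\to\infty$, to a real random variable $W_\psi$ whose law does not depend on the choice of $\mathcal{C}$; $W_\psi$ is integrable, and $$E[W_\psi]=\mathrm{tr}\Big(E\big[ZZ^T\|Q_cZ\|^2\psi(Y)^2\big]\,P_c\,(P_cM_\psi-\lambda^*_\psi I)^{-2}\Big).$$ Here $P_c(P_cM_\psi-\lambda^*_\psi I)^{-2}$ denotes the matrix that vanishes on $E_c^\perp$ and equals on $E_c$ the squared inverse of the (invertible) restriction of $P_cM_\psi-\lambda^*_\psi I$ to $E_c$. If $\lambda^*_\psi\ne0$, then $P_cM_\psi-\lambda^*_\psi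 I$ is invertible on all of $\mathbb{R}^p$ and the expression may be read literally as a product of matrices. -/

import Mathlib

open MeasureTheory ProbabilityTheory Filter Topology

noncomputable section

/-- Matrix (in the standard basis) of the orthogonal projection onto a subspace `E` of `ℝ^p`. -/
def projMatrix {p : ℕ} (E : Submodule ℝ (EuclideanSpace ℝ (Fin p))) :
    Matrix (Fin p) (Fin p) ℝ :=
  (Matrix.toEuclideanCLM (n := Fin p) (𝕜 := ℝ)).symm E.starProjection

/-- The σ-algebra generated by `P_E Z`, with `P_E` the orthogonal projection onto `E`. -/
abbrev projSigma {Ω : Type*} {p : ℕ} (E : Submodule ℝ (EuclideanSpace ℝ (Fin p)))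
    (Z : Ω → EuclideanSpace ℝ (Fin p)) : MeasurableSpace Ω :=
  MeasurableSpace.comap (fun ω => E.starProjection (Z ω)) inferInstance

/-- `E` is a dimension reduction subspace: `Y` and `Z` are conditionally independent given
`P_E Z`. (Conditional independence of random variables, on any probability space; on a standard
Borel space it is Mathlib's `CondIndepFun`.) -/
def IsDRS {Ω : Type*} [MeasurableSpace Ω] {p : ℕ} (μ : Measure Ω)
    (Z : Ω → EuclideanSpace ℝ (Fin p)) (Y : Ω → ℝ)
    (E : Submodule ℝ (EuclideanSpace ℝ (Fin p))) : Prop :=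
  ∀ (A : Set ℝ) (B : Set (EuclideanSpace ℝ (Fin p))), MeasurableSet A → MeasurableSet B →
    (μ⟦Y ⁻¹' A ∩ Z ⁻¹' B | projSigma E Z⟧) =ᵐ[μ]
      fun ω => (μ⟦Y ⁻¹' A | projSigma E Z⟧) ω * (μ⟦Z ⁻¹' B | projSigma E Z⟧) ω

/-- `E` is the central subspace: the unique dimension reduction subspace of minimal dimension. -/
def IsCentralSubspace {Ω : Type*} [MeasurableSpace Ω] {p : ℕ} (μ : Measure Ω)
    (Z : Ω → EuclideanSpace ℝ (Fin p)) (Y : Ω → ℝ)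
    (E : Submodule ℝ (EuclideanSpace ℝ (Fin p))) : Prop :=
  IsDRS μ Z Y E ∧
    ∀ F : Submodule ℝ (EuclideanSpace ℝ (Fin p)), IsDRS μ Z Y F → F ≠ E →
      Module.finrank ℝ E < Module.finrank ℝ F

/-- Linearity condition: `Q_c E[Z | P_c Z] = 0` almost surely, where `Q_c = I - P_c`. -/
def LinearityCondition {Ω : Type*} [MeasurableSpace Ω] {p : ℕ} (μ : Measure Ω)
    (Z : Ω → EuclideanSpace ℝ (Fin p)) (E : Submodule ℝ (EuclideanSpace ℝ (Fin p))) : Prop :=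
  ∀ᵐ ω ∂μ, Eᗮ.starProjection ((μ[Z | projSigma E Z]) ω) = 0

/-- Conditional covariance matrix `var(Z | m)`. -/
def condCovMatrix {Ω : Type*} {p : ℕ} (m : MeasurableSpace Ω) [mΩ : MeasurableSpace Ω]
    (μ : Measure Ω)
    (Z : Ω → EuclideanSpace ℝ (Fin p)) (ω : Ω) : Matrix (Fin p) (Fin p) ℝ :=
  Matrix.of fun i j =>
    (μ[fun ω' => (Z ω' i - (μ[fun ω'' => Z ω'' i | m]) ω') *
        (Z ω' j - (μ[fun ω'' => Z ω'' j | m]) ω') | m]) ω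

/-- Diagonal conditional variance: `var(Z | P_c Z) = lam • Q_c` almost surely for some real
random variable `lam`. -/
def DiagonalCondVar {Ω : Type*} [MeasurableSpace Ω] {p : ℕ} (μ : Measure Ω)
    (Z : Ω → EuclideanSpace ℝ (Fin p)) (E : Submodule ℝ (EuclideanSpace ℝ (Fin p))) : Prop :=
  ∃ lam : Ω → ℝ, Measurable lam ∧
    ∀ᵐ ω ∂μ, condCovMatrix (projSigma E Z) μ Z ω = lam ω • (1 - projMatrix E)

/-- `M_ψ = E[Z Zᵀ ψ(Y)]`. -/
def psiMatrix {Ω : Type*} [MeasurableSpace Ω] {p : ℕ} (μ : Measure Ω)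
    (Z : Ω → EuclideanSpace ℝ (Fin p)) (Y : Ω → ℝ) (ψ : ℝ → ℝ) : Matrix (Fin p) (Fin p) ℝ :=
  Matrix.of fun i j => ∫ ω, Z ω i * Z ω j * ψ (Y ω) ∂μ

/-- `λ*_ψ = E[‖Q_c Z‖² ψ(Y)] / (p - d)`, with `d = dim E`. -/
def psiLambda {Ω : Type*} [MeasurableSpace Ω] {p : ℕ} (μ : Measure Ω)
    (Z : Ω → EuclideanSpace ℝ (Fin p)) (Y : Ω → ℝ) (ψ : ℝ → ℝ)
    (E : Submodule ℝ (EuclideanSpace ℝ (Fin p))) : ℝ :=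
  ((p : ℝ) - (Module.finrank ℝ E : ℝ))⁻¹ * ∫ ω, ‖Eᗮ.starProjection (Z ω)‖ ^ 2 * ψ (Y ω) ∂μ

/-- The `ψ`-space: the column space of `M_ψ - λ*_ψ I`. -/
def psiSpace {Ω : Type*} [MeasurableSpace Ω] {p : ℕ} (μ : Measure Ω)
    (Z : Ω → EuclideanSpace ℝ (Fin p)) (Y : Ω → ℝ) (ψ : ℝ → ℝ)
    (E : Submodule ℝ (EuclideanSpace ℝ (Fin p))) : Submodule ℝ (EuclideanSpace ℝ (Fin p)) :=
  LinearMap.range (Matrix.toEuclideanLin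
    (psiMatrix μ Z Y ψ - psiLambda μ Z Y ψ E • (1 : Matrix (Fin p) (Fin p) ℝ)))

/-- `E[Z Zᵀ ‖Q_c Z‖² ψ(Y)²]`. -/
def psiFourthMatrix {Ω : Type*} [MeasurableSpace Ω] {p : ℕ} (μ : Measure Ω)
    (Z : Ω → EuclideanSpace ℝ (Fin p)) (Y : Ω → ℝ) (ψ : ℝ → ℝ)
    (E : Submodule ℝ (EuclideanSpace ℝ (Fin p))) : Matrix (Fin p) (Fin p) ℝ :=
  Matrix.of fun i j => ∫ ω, Z ω i * Z ω j * ‖Eᗮ.starProjection (Z ω)‖ ^ 2 * ψ (Y ω) ^ 2 ∂μ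

/-- The empirical matrix `n⁻¹ ∑ Z_i Z_iᵀ ψ(Y_i)` of a sample of size `n`. -/
def empPsiMatrix {Ω : Type*} {p : ℕ} (Zs : ℕ → Ω → EuclideanSpace ℝ (Fin p)) (Ys : ℕ → Ω → ℝ)
    (ψ : ℝ → ℝ) (n : ℕ) (ω : Ω) : Matrix (Fin p) (Fin p) ℝ :=
  Matrix.of fun j k => (n : ℝ)⁻¹ * ∑ i ∈ Finset.range n, Zs i ω j * Zs i ω k * ψ (Ys i ω)

/-- The contour integral `∮_γ f(z) dz` of a complex function along a closed path. -/
def contourIntegral (f : ℂ → ℂ) {a : ℂ} (γ : Path a a) : ℂ :=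
  curveIntegral (fun z => ContinuousLinearMap.toSpanSingleton ℂ (f z)) γ

/-- Winding number of the closed path `γ` around `w`. -/
def contourIndex {a : ℂ} (γ : Path a a) (w : ℂ) : ℂ :=
  (2 * Real.pi * Complex.I)⁻¹ * contourIntegral (fun z => (z - w)⁻¹) γ

/-- Regularity of a contour: differentiable off a countable set of parameters, with integrable
derivative. Every piecewise continuously differentiable closed path is of this kind. -/
def IsRegularContour {a : ℂ} (γ : Path a a) : Prop :=
  (∃ S : Set ℝ, S.Countable ∧ ∀ t ∈ Set.Ioo (0 : ℝ) 1 \ S, DifferentiableAt ℝ γ.extend t) ∧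
    IntervalIntegrable (deriv γ.extend) volume 0 1

/-- `γ` encloses (once, counterclockwise) all the eigenvalues of the symmetric real matrix `M`
that differ from `lam`, and leaves `lam` outside. -/
structure EnclosesEigenvaluesExcept {a : ℂ} (γ : Path a a) {p : ℕ}
    (M : Matrix (Fin p) (Fin p) ℝ) (lam : ℝ) : Prop where
  regular : IsRegularContour γ
  avoids : ∀ x ∈ spectrum ℝ M, (x : ℂ) ∉ Set.range γ
  avoids_lam : (lam : ℂ) ∉ Set.range γ
  index_eq_one : ∀ x ∈ spectrum ℝ M, x ≠ lam → contourIndex γ (x : ℂ) = 1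
  index_lam : contourIndex γ (lam : ℂ) = 0

/-- Riesz projection `(2πi)⁻¹ ∮_γ (z I - M)⁻¹ dz`, integrated entry by entry. -/
def rieszProj {a : ℂ} (γ : Path a a) {p : ℕ} (M : Matrix (Fin p) (Fin p) ℝ) :
    Matrix (Fin p) (Fin p) ℂ :=
  Matrix.of fun i j => (2 * Real.pi * Complex.I)⁻¹ *
    contourIntegral
      (fun z => (z • (1 : Matrix (Fin p) (Fin p) ℂ) - M.map Complex.ofReal)⁻¹ i j) γ

/-- For a projection matrix `P` onto `E` and a matrix `T` whose compression to `E` is invertible,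
the inverse of that compression, extended by the identity of the orthogonal complement of `E`.
So `P * (invOnRange P T) ^ 2` is the matrix that is the squared inverse of the compression of `T`
on `E` and zero on the orthogonal complement. -/
def invOnRange {p : ℕ} (P T : Matrix (Fin p) (Fin p) ℝ) : Matrix (Fin p) (Fin p) ℝ :=
  (P * T * P + (1 - P))⁻¹

end

noncomputable section

/-! ### Contour integrals -/

section Contour

variable {a : ℂ} {γ : Path a a}

/-! Write `P` for the projection onto `E_c`, `Q = I - P`, `M = M_ψ`, `lam = λ*_ψ`, `N = M - lam I`.

Structure of `M`. If `F(Z)` has zero conditional mean given `P Z`, conditional independence makes it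
orthogonal to `ψ(Y)`. The linearity condition supplies `F(z) = (Qz)_i (Pz)_j`, and the diagonal
variance supplies `(Qz)_i (Qz)_j - Q_ij ‖Qz‖² / (p - d)`. Hence `Q M = lam Q`
(`one_sub_projMatrix_mul_psiMatrix`). By symmetry and the covering assumption, `N` vanishes on
`E_c^⊥` and is invertible on `E_c`; let `A` be its squared inverse there, extended by zero.

Second order expansion. Expand the resolvent of `M + D` in `D` inside `tr(Q ·)`. As `Q` absorbs
neighbouring resolvents into factors `(z - lam)⁻¹`, the order zero term integrates to the winding
number of `lam`, which is zero; the first order term has a primitive; the second order term has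
residue `tr(Q D A D)`; the rest is `O(‖D‖³)` uniformly on the contour
(`exists_norm_trace_mul_rieszProj_sub_le`).

Limit. By the central limit theorem the empirical matrix is `M + n^{-1/2} G_n` with `G_n` converging
to a centred Gaussian matrix `G`. Multiplication by `n` leaves `tr(Q G_n A G_n)` plus an error of
order `n^{-1/2} ‖G_n‖³`, so the limit is `W = tr(Q G A G)`, in which the contour no longer appears.

Mean. `G` has the covariance of `V = Z Zᵀ ψ(Y)`, so `E W = E tr(Q V A V) - tr(Q M A M)`. The last
trace is zero because `Q M = lam Q` and `Q A = 0`. As `V` has rank at most one, `tr(Q V A V) = ‖Q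
Z‖² ψ(Y)² ZᵀA Z`, which gives the formula. -/

theorem contourIntegral_eq_intervalIntegral (f : ℂ → ℂ) (γ : Path a a) :
    contourIntegral f γ = ∫ t in (0 : ℝ)..1, deriv γ.extend t * f (γ.extend t) := by
  rw [contourIntegral, curveIntegral_eq_intervalIntegral_deriv]
  simp

theorem Path.extend_mem_range_coe (γ : Path a a) (t : ℝ) : γ.extend t ∈ Set.range γ := by
  rw [← γ.extend_range]; exact Set.mem_range_self t

theorem IsRegularContour.intervalIntegrable (hγ : IsRegularContour γ) {f : ℂ → ℂ}
    (hf : ContinuousOn f (Set.range γ)) :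
    IntervalIntegrable (fun t => deriv γ.extend t * f (γ.extend t)) volume 0 1 :=
  hγ.2.mul_continuousOn
    (hf.comp γ.continuous_extend.continuousOn fun t _ => γ.extend_mem_range_coe t)

/-- Fundamental theorem of calculus for `F ∘ γ.extend`, which takes equal values at the two ends of
a closed path. A countable set of parameters without derivative is harmless. -/
theorem contourIntegral_eq_zero_of_hasDerivAt (hγ : IsRegularContour γ) {F f : ℂ → ℂ}
    (hf : ContinuousOn f (Set.range γ)) (hF : ∀ z ∈ Set.range γ, HasDerivAt F (f z) z) :
    contourIntegral f γ = 0 := by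
  obtain ⟨S, hS, hd⟩ := hγ.1
  rw [contourIntegral_eq_intervalIntegral,
    MeasureTheory.integral_eq_of_hasDerivAt_off_countable_of_le (F ∘ γ.extend) _ zero_le_one hS]
  · simp
  · intro t _
    exact ((hF _ (γ.extend_mem_range_coe t)).continuousAt.comp
      γ.continuous_extend.continuousAt).continuousWithinAt
  · intro t ht
    rw [mul_comm]
    exact (hF _ (γ.extend_mem_range_coe t)).comp t (hd t ht).hasDerivAt
  · exact hγ.intervalIntegrable hf

theorem contourIntegral_add (hγ : IsRegularContour γ) {f g : ℂ → ℂ}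
    (hf : ContinuousOn f (Set.range γ)) (hg : ContinuousOn g (Set.range γ)) :
    contourIntegral (fun z => f z + g z) γ = contourIntegral f γ + contourIntegral g γ := by
  simp only [contourIntegral_eq_intervalIntegral, mul_add]
  exact intervalIntegral.integral_add (hγ.intervalIntegrable hf) (hγ.intervalIntegrable hg)

theorem contourIntegral_const_mul (c : ℂ) (f : ℂ → ℂ) (γ : Path a a) :
    contourIntegral (fun z => c * f z) γ = c * contourIntegral f γ := by
  simp only [contourIntegral_eq_intervalIntegral, mul_left_comm _ c]
  exact intervalIntegral.integral_const_mul _ _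

theorem contourIntegral_mul_const (c : ℂ) (f : ℂ → ℂ) (γ : Path a a) :
    contourIntegral (fun z => f z * c) γ = contourIntegral f γ * c := by
  simp only [mul_comm _ c, contourIntegral_const_mul]

theorem contourIntegral_sum {ι : Type*} (s : Finset ι) (hγ : IsRegularContour γ) {f : ι → ℂ → ℂ}
    (hf : ∀ i, ContinuousOn (f i) (Set.range γ)) :
    contourIntegral (fun z => ∑ i ∈ s, f i z) γ = ∑ i ∈ s, contourIntegral (f i) γ := by
  simp only [contourIntegral_eq_intervalIntegral, Finset.mul_sum]
  exact intervalIntegral.integral_finsetSum fun i _ => hγ.intervalIntegrable (hf i)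

theorem contourIntegral_congr {f g : ℂ → ℂ} (h : ∀ z ∈ Set.range γ, f z = g z) :
    contourIntegral f γ = contourIntegral g γ := by
  simp only [contourIntegral_eq_intervalIntegral]
  congr 1; ext t
  rw [h _ (γ.extend_mem_range_coe t)]

theorem norm_contourIntegral_le (hγ : IsRegularContour γ) {f : ℂ → ℂ} {C : ℝ}
    (hf : ∀ z ∈ Set.range γ, ‖f z‖ ≤ C) :
    ‖contourIntegral f γ‖ ≤ C * ∫ t in (0 : ℝ)..1, ‖deriv γ.extend t‖ := by
  rw [contourIntegral_eq_intervalIntegral, ← intervalIntegral.integral_const_mul]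
  refine intervalIntegral.norm_integral_le_of_norm_le zero_le_one (ae_of_all _ fun t _ => ?_)
    (hγ.2.norm.const_mul C)
  rw [norm_mul, mul_comm]
  exact mul_le_mul_of_nonneg_right (hf _ (γ.extend_mem_range_coe t)) (norm_nonneg _)

theorem continuousOn_inv_sub {s : Set ℂ} {w : ℂ} (hw : w ∉ s) :
    ContinuousOn (fun z => (z - w)⁻¹) s :=
  ContinuousOn.inv₀ (by fun_prop) fun z hz h => hw (by rwa [← sub_eq_zero.1 h])

theorem contourIntegral_inv_sub (γ : Path a a) (w : ℂ) :
    contourIntegral (fun z => (z - w)⁻¹) γ = 2 * Real.pi * Complex.I * contourIndex γ w := by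
  have : (2 * Real.pi * Complex.I : ℂ) ≠ 0 := Complex.two_pi_I_ne_zero
  rw [contourIndex, mul_inv_cancel_left₀ this]

theorem contourIntegral_inv_sub_sq (hγ : IsRegularContour γ) {w : ℂ} (hw : w ∉ Set.range γ) :
    contourIntegral (fun z => (z - w)⁻¹ ^ 2) γ = 0 := by
  refine contourIntegral_eq_zero_of_hasDerivAt (F := fun z => -(z - w)⁻¹) hγ
    ((continuousOn_inv_sub hw).pow 2) fun z hz => ?_
  have hz' : z - w ≠ 0 := fun h => hw (by rwa [← sub_eq_zero.1 h])
  convert! (((hasDerivAt_id z).sub_const w).inv hz').neg using 1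
  simp [field]

theorem contourIntegral_inv_sub_cube (hγ : IsRegularContour γ) {w : ℂ} (hw : w ∉ Set.range γ) :
    contourIntegral (fun z => (z - w)⁻¹ ^ 3) γ = 0 := by
  refine contourIntegral_eq_zero_of_hasDerivAt (F := fun z => -(1 / 2) * (z - w)⁻¹ ^ 2) hγ
    ((continuousOn_inv_sub hw).pow 3) fun z hz => ?_
  have hz' : z - w ≠ 0 := fun h => hw (by rwa [← sub_eq_zero.1 h])
  convert! ((((hasDerivAt_id z).sub_const w).inv hz').pow 2).const_mul (-(1 / 2) : ℂ) using 1
  simp [field]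

/-- Partial fractions: the simple poles at `x` and `w` carry opposite residues `±(x - w)⁻²`, and the
double pole at `w` has a primitive. -/
theorem contourIntegral_inv_sub_sq_mul_inv_sub (hγ : IsRegularContour γ) {w x : ℂ}
    (hw : w ∉ Set.range γ) (hx : x ∉ Set.range γ) (hxw : x ≠ w) :
    contourIntegral (fun z => (z - w)⁻¹ ^ 2 * (z - x)⁻¹) γ =
      2 * Real.pi * Complex.I * ((x - w)⁻¹ ^ 2 * (contourIndex γ x - contourIndex γ w)) := by
  have hw' := continuousOn_inv_sub hw
  have hx' := continuousOn_inv_sub hx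
  have h : ∀ z ∈ Set.range γ, (z - w)⁻¹ ^ 2 * (z - x)⁻¹ =
      (x - w)⁻¹ ^ 2 * (z - x)⁻¹ + (-(x - w)⁻¹ ^ 2 * (z - w)⁻¹ +
        -(x - w)⁻¹ * (z - w)⁻¹ ^ 2) := by
    intro z hz
    have h1 : z - w ≠ 0 := fun h => hw (by rwa [← sub_eq_zero.1 h])
    have h2 : z - x ≠ 0 := fun h => hx (by rwa [← sub_eq_zero.1 h])
    have h3 : x - w ≠ 0 := sub_ne_zero.2 hxw
    field_simp
    ring
  rw [contourIntegral_congr h, contourIntegral_add hγ, contourIntegral_add hγ,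
    contourIntegral_const_mul, contourIntegral_const_mul, contourIntegral_const_mul,
    contourIntegral_inv_sub_sq hγ hw, contourIntegral_inv_sub, contourIntegral_inv_sub]
  · ring
  all_goals fun_prop

end Contour

/-! ### Resolvents of real symmetric matrices -/

section Resolvent

variable {p : ℕ}

/-- The resolvent `(z I - X)⁻¹` of a real matrix, as a complex matrix. -/
def matResolvent (X : Matrix (Fin p) (Fin p) ℝ) (z : ℂ) : Matrix (Fin p) (Fin p) ℂ :=
  (z • (1 : Matrix (Fin p) (Fin p) ℂ) - X.map Complex.ofReal)⁻¹

theorem map_ofReal_mul (X Y : Matrix (Fin p) (Fin p) ℝ) :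
    (X * Y).map Complex.ofReal = X.map Complex.ofReal * Y.map Complex.ofReal :=
  Matrix.map_mul (f := Complex.ofRealHom)

theorem map_ofReal_add (X Y : Matrix (Fin p) (Fin p) ℝ) :
    (X + Y).map Complex.ofReal = X.map Complex.ofReal + Y.map Complex.ofReal := by
  ext; simp

theorem map_ofReal_smul (c : ℝ) (X : Matrix (Fin p) (Fin p) ℝ) :
    (c • X).map Complex.ofReal = (c : ℂ) • X.map Complex.ofReal := by
  ext; simp

theorem map_ofReal_one :
    (1 : Matrix (Fin p) (Fin p) ℝ).map Complex.ofReal = 1 :=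
  Matrix.map_one _ Complex.ofReal_zero Complex.ofReal_one

theorem trace_map_ofReal (X : Matrix (Fin p) (Fin p) ℝ) :
    (X.map Complex.ofReal).trace = (X.trace : ℂ) := by
  simp [Matrix.trace]

/-- Spectral theorem in explicit real form, so that one `U` diagonalises both the real polynomials
in `M` and the complex resolvent. -/
theorem Matrix.IsHermitian.exists_eq_mul_diagonal_mul_transpose {M : Matrix (Fin p) (Fin p) ℝ}
    (hM : M.IsHermitian) :
    ∃ (U : Matrix (Fin p) (Fin p) ℝ) (x : Fin p → ℝ), U * U.transpose = 1 ∧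
      U.transpose * U = 1 ∧ M = U * Matrix.diagonal x * U.transpose ∧
      ∀ k, x k ∈ spectrum ℝ M := by
  refine ⟨hM.eigenvectorUnitary, hM.eigenvalues, ?_, ?_, ?_, hM.eigenvalues_mem_spectrum_real⟩
  · simpa [Matrix.star_eq_conjTranspose] using Unitary.coe_mul_star_self hM.eigenvectorUnitary
  · simpa [Matrix.star_eq_conjTranspose] using Unitary.coe_star_mul_self hM.eigenvectorUnitary
  · have := hM.spectral_theorem
    rw [Unitary.conjStarAlgAut_apply] at this
    simpa [Matrix.star_eq_conjTranspose, Function.comp_def] using this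

theorem smul_one_sub_map_mul_eq_one {U : Matrix (Fin p) (Fin p) ℝ} {x : Fin p → ℝ}
    (hU : U * U.transpose = 1) (hU' : U.transpose * U = 1) {z : ℂ} (hz : ∀ k, (x k : ℂ) ≠ z) :
    (z • (1 : Matrix (Fin p) (Fin p) ℂ) -
        (U * Matrix.diagonal x * U.transpose).map Complex.ofReal) *
      (U.map Complex.ofReal * Matrix.diagonal (fun k => (z - x k)⁻¹) *
        U.transpose.map Complex.ofReal) = 1 := by
  have h1 : U.map Complex.ofReal * U.transpose.map Complex.ofReal = 1 := by
    rw [← map_ofReal_mul, hU, map_ofReal_one]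
  have h2 : U.transpose.map Complex.ofReal * U.map Complex.ofReal = 1 := by
    rw [← map_ofReal_mul, hU', map_ofReal_one]
  have h3 : z • (1 : Matrix (Fin p) (Fin p) ℂ) -
        (U * Matrix.diagonal x * U.transpose).map Complex.ofReal =
      U.map Complex.ofReal * Matrix.diagonal (fun k => z - x k) *
        U.transpose.map Complex.ofReal := by
    have : (Matrix.diagonal (fun k => z - x k) : Matrix (Fin p) (Fin p) ℂ) =
        z • 1 - (Matrix.diagonal x).map Complex.ofReal := by
      ext i j
      by_cases h : i = j
      · subst h; simp
      · simp [h]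
    rw [this, mul_sub, sub_mul, map_ofReal_mul, map_ofReal_mul, Matrix.mul_smul, mul_one,
      Matrix.smul_mul, h1]
  rw [h3]
  have h4 : (Matrix.diagonal (fun k => z - x k) : Matrix (Fin p) (Fin p) ℂ) *
      Matrix.diagonal (fun k => (z - x k)⁻¹) = 1 := by
    rw [Matrix.diagonal_mul_diagonal, ← Matrix.diagonal_one]
    congr 1; ext k
    exact mul_inv_cancel₀ (sub_ne_zero.2 (hz k).symm)
  calc _ = U.map Complex.ofReal * (Matrix.diagonal (fun k => z - x k) *
        (U.transpose.map Complex.ofReal * U.map Complex.ofReal) *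
        Matrix.diagonal (fun k => (z - x k)⁻¹)) * U.transpose.map Complex.ofReal := by
        simp only [mul_assoc]
    _ = 1 := by rw [h2, mul_one, h4, mul_one, h1]

theorem isUnit_smul_one_sub_of_forall_spectrum_ne {M : Matrix (Fin p) (Fin p) ℝ}
    (hM : M.IsHermitian) {z : ℂ} (hz : ∀ x ∈ spectrum ℝ M, (x : ℂ) ≠ z) :
    IsUnit (z • (1 : Matrix (Fin p) (Fin p) ℂ) - M.map Complex.ofReal) := by
  obtain ⟨U, x, hU, hU', rfl, hx⟩ := hM.exists_eq_mul_diagonal_mul_transpose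
  exact IsUnit.of_mul_eq_one _ (smul_one_sub_map_mul_eq_one hU hU' fun k => hz _ (hx k))

/-- Cramer's rule: the adjugate is polynomial in `z`, and the determinant does not vanish on `s`. -/
theorem continuousOn_matResolvent {X : Matrix (Fin p) (Fin p) ℝ} {s : Set ℂ}
    (h : ∀ z ∈ s, IsUnit (z • (1 : Matrix (Fin p) (Fin p) ℂ) - X.map Complex.ofReal)) :
    ContinuousOn (matResolvent X) s := by
  have hc : Continuous fun z : ℂ =>
      z • (1 : Matrix (Fin p) (Fin p) ℂ) - X.map Complex.ofReal := by fun_prop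
  unfold matResolvent
  simp only [Matrix.inv_def, Ring.inverse_eq_inv']
  refine ContinuousOn.smul (hc.matrix_det.continuousOn.inv₀ fun z hz => ?_)
    hc.matrix_adjugate.continuousOn
  exact ((Matrix.isUnit_iff_isUnit_det _).1 (h z hz)).ne_zero

theorem matResolvent_of_eq {U : Matrix (Fin p) (Fin p) ℝ} {x : Fin p → ℝ}
    (hU : U * U.transpose = 1) (hU' : U.transpose * U = 1) {z : ℂ} (hz : ∀ k, (x k : ℂ) ≠ z)
    (i j : Fin p) :
    matResolvent (U * Matrix.diagonal x * U.transpose) z i j =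
      ∑ k, (U i k : ℂ) * U j k * (z - x k)⁻¹ := by
  rw [matResolvent, Matrix.inv_eq_right_inv (smul_one_sub_map_mul_eq_one hU hU' hz),
    Matrix.mul_apply]
  refine Finset.sum_congr rfl fun k _ => ?_
  rw [Matrix.mul_diagonal]
  simp
  ring

/-- The second order residue of the resolvent: `(2πi)⁻¹ ∮ (z - lam)⁻² (z I - M)⁻¹ dz = A`, where
`A` is the squared inverse of `N = M - lam I` on the range of `N` and vanishes on its kernel. -/
theorem contourIntegral_inv_sq_mul_matResolvent {a : ℂ} {γ : Path a a}
    {M P A : Matrix (Fin p) (Fin p) ℝ} {lam : ℝ} (hM : M.IsHermitian)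
    (hγ : EnclosesEigenvaluesExcept γ M lam)
    (hNP : (M - lam • 1) * P = M - lam • 1) (hPA : P * A = A)
    (hNA : (M - lam • 1) * (M - lam • 1) * A = P) (i j : Fin p) :
    contourIntegral (fun z => (z - lam)⁻¹ ^ 2 * matResolvent M z i j) γ =
      2 * Real.pi * Complex.I * (A i j : ℝ) := by
  obtain ⟨U, x, hU, hU', hMU, hx⟩ := hM.exists_eq_mul_diagonal_mul_transpose
  set N := M - lam • (1 : Matrix (Fin p) (Fin p) ℝ) with hN
  -- Since `0⁻¹ = 0`, `c` vanishes at the eigenvalues equal to `lam`, so `C` below is the squared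
  -- pseudo-inverse of `N`.
  set c : Fin p → ℝ := fun k => (x k - lam)⁻¹ ^ 2 with hc
  have key : ∀ d e : Fin p → ℝ, (U * Matrix.diagonal d * U.transpose) *
      (U * Matrix.diagonal e * U.transpose) =
        U * Matrix.diagonal (fun k => d k * e k) * U.transpose := by
    intro d e
    calc _ = U * (Matrix.diagonal d * (U.transpose * U) * Matrix.diagonal e) * U.transpose := by
          simp only [mul_assoc]
      _ = _ := by rw [hU', mul_one, Matrix.diagonal_mul_diagonal]
  have hNU : N = U * Matrix.diagonal (fun k => x k - lam) * U.transpose := by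
    have : (Matrix.diagonal (fun k => x k - lam) : Matrix (Fin p) (Fin p) ℝ) =
        Matrix.diagonal x - lam • 1 := by
      ext i j
      by_cases h : i = j
      · subst h; simp
      · simp [h]
    rw [this, mul_sub, sub_mul, ← hMU, Matrix.mul_smul, mul_one, Matrix.smul_mul, hU]
  set C := U * Matrix.diagonal c * U.transpose with hC
  have hCN : C * (N * N) * N = N := by
    rw [hNU, hC]
    simp only [key]
    congr 3; ext k
    simp only [hc]
    by_cases h : x k - lam = 0
    · simp [h]
    · field_simp
  have hCC : C * (C * (N * N)) = C := by
    rw [hNU, hC]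
    simp only [key]
    congr 3; ext k
    simp only [hc]
    by_cases h : x k - lam = 0
    · simp [h]
    · field_simp
  clear_value C
  -- The three hypotheses on `P` and `A` determine them: `C N²` must be `P`, and then `C` must be
  -- `A`.
  have hE : C * (N * N) = P := by
    calc C * (N * N) = C * (N * N) * P := by simp only [mul_assoc, hNP]
      _ = C * (N * N) * N * (N * A) := by rw [← hNA]; simp only [mul_assoc]
      _ = P := by rw [hCN, ← mul_assoc, hNA]
  have hCA : C = A := by
    calc C = C * P := by rw [← hE, hCC]
      _ = C * (N * N) * A := by rw [← hNA]; simp only [mul_assoc]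
      _ = A := by rw [hE, hPA]
  have hne : ∀ z ∈ Set.range γ, ∀ k, (x k : ℂ) ≠ z := fun z hz k h =>
    hγ.avoids _ (hx k) (h ▸ hz)
  have hxr : ∀ k, (x k : ℂ) ∉ Set.range γ := fun k => hγ.avoids _ (hx k)
  have hcont : ∀ k, ContinuousOn (fun z : ℂ => (U i k : ℂ) * U j k *
      ((z - lam)⁻¹ ^ 2 * (z - x k)⁻¹)) (Set.range γ) := fun k =>
    continuousOn_const.mul (((continuousOn_inv_sub hγ.avoids_lam).pow 2).mul
      (continuousOn_inv_sub (hxr k)))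
  rw [contourIntegral_congr (g := fun z => ∑ k, (U i k : ℂ) * U j k *
      ((z - lam)⁻¹ ^ 2 * (z - x k)⁻¹)), contourIntegral_sum _ hγ.regular hcont]
  · rw [← hCA, hC, Matrix.mul_apply]
    simp only [Matrix.mul_diagonal, Matrix.transpose_apply]
    push_cast
    rw [Finset.mul_sum]
    refine Finset.sum_congr rfl fun k _ => ?_
    rw [contourIntegral_const_mul]
    -- At the eigenvalue `lam` the integrand is a pure triple pole with zero integral, in agreement
    -- with `c k = 0`.
    by_cases h : x k = lam
    · have : ∀ z : ℂ, (z - lam)⁻¹ ^ 2 * (z - x k)⁻¹ = (z - lam)⁻¹ ^ 3 := by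
        intro z; rw [h]; ring
      simp only [this]
      rw [contourIntegral_inv_sub_cube hγ.regular hγ.avoids_lam]
      simp [hc, h]
    · rw [contourIntegral_inv_sub_sq_mul_inv_sub hγ.regular hγ.avoids_lam (hxr k)
        (by exact_mod_cast h), hγ.index_eq_one _ (hx k) h, hγ.index_lam]
      simp [hc]
      ring
  · intro z hz
    rw [hMU, matResolvent_of_eq hU hU' (hne z hz), Finset.mul_sum]
    exact Finset.sum_congr rfl fun k _ => by ring

end Resolvent

/-! ### Second order expansion of the Riesz projection -/

section Expansion

open scoped Matrix.Norms.Operator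

variable {p : ℕ}

theorem continuousOn_entry {F : ℂ → Matrix (Fin p) (Fin p) ℂ} {s : Set ℂ} (hF : ContinuousOn F s)
    (i j : Fin p) : ContinuousOn (fun z => F z i j) s :=
  (continuous_apply_apply (ρ := fun _ _ => ℂ) i j).comp_continuousOn hF

theorem norm_trace_le (X : Matrix (Fin p) (Fin p) ℂ) : ‖X.trace‖ ≤ p * ‖X‖ := by
  have h : ∀ i ∈ Finset.univ, ‖X i i‖ ≤ ‖X‖ := fun i _ => by
    rw [Matrix.linfty_opNorm_def]
    have h1 : ‖X i i‖₊ ≤ ∑ j, ‖X i j‖₊ :=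
      Finset.single_le_sum (f := fun j => ‖X i j‖₊) (fun _ _ => zero_le) (Finset.mem_univ i)
    exact_mod_cast h1.trans
      (Finset.le_sup (f := fun i => ∑ j, ‖X i j‖₊) (Finset.mem_univ i))
  simpa [Matrix.trace] using (norm_sum_le _ _).trans (Finset.sum_le_card_nsmul _ _ _ h)

theorem trace_mul_rieszProj {a : ℂ} {γ : Path a a} (hγ : IsRegularContour γ)
    (Q : Matrix (Fin p) (Fin p) ℂ) (X : Matrix (Fin p) (Fin p) ℝ)
    (hX : ContinuousOn (matResolvent X) (Set.range γ)) :
    (Q * rieszProj γ X).trace =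
      (2 * Real.pi * Complex.I)⁻¹ * contourIntegral (fun z => (Q * matResolvent X z).trace) γ := by
  have hij : ∀ i j, ContinuousOn (fun z => Q i j * matResolvent X z j i) (Set.range γ) :=
    fun i j => continuousOn_const.mul (continuousOn_entry hX j i)
  simp only [Matrix.trace, Matrix.diag, Matrix.mul_apply]
  rw [contourIntegral_sum _ hγ fun i => continuousOn_finsetSum _ fun j _ => hij i j, Finset.mul_sum]
  refine Finset.sum_congr rfl fun i _ => ?_
  rw [contourIntegral_sum _ hγ fun j => hij i j, Finset.mul_sum]
  refine Finset.sum_congr rfl fun j _ => ?_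
  rw [contourIntegral_const_mul]
  simp only [rieszProj, Matrix.of_apply, matResolvent]
  ring

/-- Here `T = z I - M`, `R` is the resolvent of `M`, `S` that of `M + D`, and `w = z - lam`. The
identity `S = R + R D S` is unrolled three times. Each `R` adjacent to `Q`, on the left directly and
on the right through cyclicity of the trace, becomes `w⁻¹`; thus the quadratic term keeps a single
`R`. -/
theorem trace_mul_resolvent_expansion {Q T D R S : Matrix (Fin p) (Fin p) ℂ} {w : ℂ} (hw : w ≠ 0)
    (hTR : T * R = 1) (hS : S * (T - D) = 1) (hQT : Q * T = w • Q) (hTQ : T * Q = w • Q) :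
    (Q * S).trace = w⁻¹ * Q.trace + w⁻¹ ^ 2 * (Q * D).trace + w⁻¹ ^ 2 * (D * Q * D * R).trace +
      w⁻¹ * (Q * D * R * D * R * D * S).trace := by
  have hRT : R * T = 1 := mul_eq_one_comm.1 hTR
  have hS' : (T - D) * S = 1 := mul_eq_one_comm.1 hS
  have hQR : Q * R = w⁻¹ • Q := by
    have : w • (Q * R) = Q := by rw [← Matrix.smul_mul, ← hQT, mul_assoc, hTR, mul_one]
    rw [← this, smul_smul, inv_mul_cancel₀ hw, one_smul, this]
  have hRQ : R * Q = w⁻¹ • Q := by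
    have : w • (R * Q) = Q := by rw [← Matrix.mul_smul, ← hTQ, ← mul_assoc, hRT, one_mul]
    rw [← this, smul_smul, inv_mul_cancel₀ hw, one_smul, this]
  have h1 : S = R + R * D * S := by
    have : R * ((T - D) * S) = S - R * D * S := by
      rw [sub_mul, mul_sub, ← mul_assoc, hRT, one_mul, mul_assoc]
    rw [hS', mul_one] at this
    exact eq_add_of_sub_eq this.symm
  have h2 : Q * S = Q * R + Q * R * D * R + Q * R * D * R * D * R +
      Q * R * D * R * D * R * D * S := by
    conv_lhs => rw [h1, h1, h1]
    noncomm_ring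
  have e2 : (Q * D * R).trace = w⁻¹ * (Q * D).trace := by
    rw [Matrix.trace_mul_comm, ← mul_assoc, hRQ, Matrix.smul_mul, Matrix.trace_smul, smul_eq_mul]
  have e3 : (Q * D * R * D * R).trace = w⁻¹ * (D * Q * D * R).trace := by
    rw [Matrix.trace_mul_comm, ← mul_assoc, ← mul_assoc, ← mul_assoc, hRQ]
    simp only [Matrix.smul_mul, Matrix.trace_smul, smul_eq_mul]
    congr 1
    rw [Matrix.trace_mul_comm]
    simp only [mul_assoc]
  rw [h2, hQR]
  simp only [Matrix.smul_mul, Matrix.trace_add, Matrix.trace_smul, smul_eq_mul, e2, e3]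
  ring

/-- Neumann series: `T - D = T (1 - R D)` with `‖R D‖ ≤ 1/2`, and `S = R + R D S` gives `‖S‖ ≤ K +
‖S‖ / 2`. -/
theorem isUnit_sub_and_norm_inv_le {A : Type*} [NormedRing A] [CompleteSpace A] [NormOneClass A]
    {T R D : A} {K : ℝ} (hTR : T * R = 1) (hRT : R * T = 1) (hR : ‖R‖ ≤ K)
    (hD : K * ‖D‖ ≤ 1 / 2) :
    IsUnit (T - D) ∧ ∀ S, S * (T - D) = 1 → ‖S‖ ≤ 2 * K := by
  have hRD : ‖R * D‖ ≤ 1 / 2 :=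
    (norm_mul_le _ _).trans ((mul_le_mul_of_nonneg_right hR (norm_nonneg _)).trans hD)
  have h1 : IsUnit (1 - R * D) := isUnit_one_sub_of_norm_lt_one (by linarith)
  have hT : IsUnit T := ⟨⟨T, R, hTR, hRT⟩, rfl⟩
  have h2 : T - D = T * (1 - R * D) := by rw [mul_sub, mul_one, ← mul_assoc, hTR, one_mul]
  have h3 : IsUnit (T - D) := h2 ▸ hT.mul h1
  refine ⟨h3, fun S hS => ?_⟩
  have hS' : (T - D) * S = 1 := by
    obtain ⟨u, hu⟩ := h3
    rw [← hu] at hS ⊢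
    rw [show S = ((u⁻¹ : Aˣ) : A) from (Units.inv_eq_of_mul_eq_one_left hS).symm, Units.mul_inv]
  have h4 : S = R + R * D * S := by
    have : R * ((T - D) * S) = S - R * D * S := by
      rw [sub_mul, mul_sub, ← mul_assoc, hRT, one_mul, mul_assoc]
    rw [hS', mul_one] at this
    exact eq_add_of_sub_eq this.symm
  have h5 : ‖S‖ ≤ K + 1 / 2 * ‖S‖ :=
    calc ‖S‖ = ‖R + R * D * S‖ := by rw [← h4]
      _ ≤ ‖R‖ + ‖R * D‖ * ‖S‖ := (norm_add_le _ _).trans (add_le_add le_rfl (norm_mul_le _ _))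
      _ ≤ K + 1 / 2 * ‖S‖ := by gcongr
  linarith

/-- Second order expansion at `M` of `X ↦ tr (Q P(X))`, with `P(X)` the Riesz projection and `Q`
a matrix of eigenvectors for the eigenvalue `lam` outside of the contour. -/
theorem exists_norm_trace_mul_rieszProj_sub_le {a : ℂ} {γ : Path a a}
    {M P Q A : Matrix (Fin p) (Fin p) ℝ} {lam : ℝ} (hM : M.IsHermitian)
    (hγ : EnclosesEigenvaluesExcept γ M lam)
    (hQM : Q * M = lam • Q) (hMQ : M * Q = lam • Q)
    (hNP : (M - lam • 1) * P = M - lam • 1) (hPA : P * A = A)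
    (hNA : (M - lam • 1) * (M - lam • 1) * A = P) :
    ∃ K : ℝ, ∃ δ > 0, ∀ D : Matrix (Fin p) (Fin p) ℝ, ‖D.map Complex.ofReal‖ ≤ δ →
      ‖(Q.map Complex.ofReal * rieszProj γ (M + D)).trace - ((Q * D * A * D).trace : ℝ)‖ ≤
        K * ‖D.map Complex.ofReal‖ ^ 3 := by
  -- The norm satisfies `‖1‖ = 1` only for `p > 0`; for `p = 0` all traces are empty sums.
  rcases Nat.eq_zero_or_pos p with hp | hp
  · subst hp
    exact ⟨0, 1, one_pos, fun D _ => by simp [Matrix.trace]⟩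
  have : Nonempty (Fin p) := ⟨⟨0, hp⟩⟩
  have hcompact : IsCompact (Set.range γ) := isCompact_range γ.continuous
  set Mc := M.map Complex.ofReal with hMc
  set Qc := Q.map Complex.ofReal with hQc
  have hunit : ∀ z ∈ Set.range γ, IsUnit (z • (1 : Matrix (Fin p) (Fin p) ℂ) - Mc) :=
    fun z hz => isUnit_smul_one_sub_of_forall_spectrum_ne hM fun x hx h =>
      hγ.avoids x hx (h ▸ hz)
  have hRcont : ContinuousOn (matResolvent M) (Set.range γ) := continuousOn_matResolvent hunit
  have hqcont : ContinuousOn (fun z : ℂ => (z - lam)⁻¹) (Set.range γ) :=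
    continuousOn_inv_sub hγ.avoids_lam
  obtain ⟨K₀, hK₀⟩ := hcompact.exists_bound_of_continuousOn hRcont
  obtain ⟨K₁, hK₁⟩ := hcompact.exists_bound_of_continuousOn hqcont
  have hK₀0 : 0 ≤ K₀ := (norm_nonneg _).trans (hK₀ _ ⟨0, rfl⟩)
  have hK₁0 : 0 ≤ K₁ := (norm_nonneg _).trans (hK₁ _ ⟨0, rfl⟩)
  have htr : Continuous (Matrix.trace : Matrix (Fin p) (Fin p) ℂ → ℂ) :=
    continuous_id.matrix_trace
  set L := ∫ t in (0 : ℝ)..1, ‖deriv γ.extend t‖ with hL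
  have hL0 : 0 ≤ L := intervalIntegral.integral_nonneg zero_le_one fun _ _ => norm_nonneg _
  have hpi : (2 * Real.pi * Complex.I : ℂ) ≠ 0 := Complex.two_pi_I_ne_zero
  -- `K₁` bounds `(z - lam)⁻¹`, `p` comes from the trace, `K₀` and `2 K₀` bound the resolvents of
  -- `M` and `M + D`, and `L` is the length of the contour. The radius ensures `K₀ ‖D‖ ≤ 1/2`; the
  -- `+ 1` keeps it meaningful if `K₀ = 0`.
  refine ⟨‖(2 * Real.pi * Complex.I : ℂ)⁻¹‖ *
    ((K₁ * (p * (‖Qc‖ * K₀ * K₀ * (2 * K₀)))) * L), 1 / (2 * (K₀ + 1)), by positivity, ?_⟩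
  intro D hD
  set Dc := D.map Complex.ofReal with hDc
  have hKD : K₀ * ‖Dc‖ ≤ 1 / 2 := by
    calc K₀ * ‖Dc‖ ≤ (K₀ + 1) * (1 / (2 * (K₀ + 1))) := by gcongr; linarith
      _ = 1 / 2 := by field_simp
  have hRr : ∀ z ∈ Set.range γ,
      (z • (1 : Matrix (Fin p) (Fin p) ℂ) - Mc) * matResolvent M z = 1 := fun z hz =>
    Matrix.mul_nonsing_inv _ ((Matrix.isUnit_iff_isUnit_det _).1 (hunit z hz))
  have hsub : ∀ z : ℂ, z • (1 : Matrix (Fin p) (Fin p) ℂ) - (M + D).map Complex.ofReal =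
      z • 1 - Mc - Dc := fun z => by rw [map_ofReal_add]; abel
  have hper := fun z hz => isUnit_sub_and_norm_inv_le (hRr z hz)
    (mul_eq_one_comm.1 (hRr z hz)) (hK₀ z hz) hKD
  have hunit' : ∀ z ∈ Set.range γ,
      IsUnit (z • (1 : Matrix (Fin p) (Fin p) ℂ) - (M + D).map Complex.ofReal) := fun z hz => by
    rw [hsub]; exact (hper z hz).1
  have hScont : ContinuousOn (matResolvent (M + D)) (Set.range γ) :=
    continuousOn_matResolvent hunit'
  have hS : ∀ z ∈ Set.range γ, matResolvent (M + D) z * (z • 1 - Mc - Dc) = 1 := fun z hz => by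
    rw [← hsub]
    exact Matrix.nonsing_inv_mul _ ((Matrix.isUnit_iff_isUnit_det _).1 (hunit' z hz))
  have hQT : ∀ z : ℂ, Qc * (z • 1 - Mc) = (z - lam) • Qc := fun z => by
    rw [mul_sub, Matrix.mul_smul, mul_one, hQc, hMc, ← map_ofReal_mul, hQM, map_ofReal_smul,
      sub_smul]
  have hTQ : ∀ z : ℂ, (z • 1 - Mc) * Qc = (z - lam) • Qc := fun z => by
    rw [sub_mul, Matrix.smul_mul, one_mul, hQc, hMc, ← map_ofReal_mul, hMQ, map_ofReal_smul,
      sub_smul]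
  set rem : ℂ → ℂ := fun z => (z - lam)⁻¹ *
    (Qc * Dc * matResolvent M z * Dc * matResolvent M z * Dc * matResolvent (M + D) z).trace
    with hrem
  have hremcont : ContinuousOn rem (Set.range γ) := by
    refine hqcont.mul (htr.comp_continuousOn ?_)
    fun_prop
  have hrembound : ∀ z ∈ Set.range γ,
      ‖rem z‖ ≤ K₁ * (p * (‖Qc‖ * K₀ * K₀ * (2 * K₀))) * ‖Dc‖ ^ 3 := by
    intro z hz
    have hR := hK₀ z hz
    have hS' := (hper z hz).2 _ (hS z hz)
    rw [hrem, norm_mul]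
    calc _ ≤ K₁ * (p * (‖Qc‖ * ‖Dc‖ * K₀ * ‖Dc‖ * K₀ * ‖Dc‖ * (2 * K₀))) := by
          refine mul_le_mul (hK₁ z hz) ((norm_trace_le _).trans ?_) (norm_nonneg _) hK₁0
          gcongr
          refine (norm_mul_le _ _).trans (mul_le_mul ?_ hS' (norm_nonneg _) (by positivity))
          refine (norm_mul_le _ _).trans (mul_le_mul ?_ le_rfl (norm_nonneg _) (by positivity))
          refine (norm_mul_le _ _).trans (mul_le_mul ?_ hR (norm_nonneg _) (by positivity))
          refine (norm_mul_le _ _).trans (mul_le_mul ?_ le_rfl (norm_nonneg _) (by positivity))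
          refine (norm_mul_le _ _).trans (mul_le_mul ?_ hR (norm_nonneg _) (by positivity))
          exact norm_mul_le _ _
      _ = _ := by ring
  have hij : ∀ i j, ContinuousOn (fun z : ℂ => (z - lam)⁻¹ ^ 2 * matResolvent M z i j)
      (Set.range γ) := fun i j =>
    (hqcont.pow 2).mul (continuousOn_entry hRcont i j)
  set G := Dc * Qc * Dc with hG
  -- The trace is expanded into entries so that the residue formula for the entries of the resolvent
  -- applies.
  have hquad : contourIntegral (fun z : ℂ => (z - lam)⁻¹ ^ 2 * (G * matResolvent M z).trace) γ =
      2 * Real.pi * Complex.I * ((Q * D * A * D).trace : ℝ) := by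
    have h1 : ∀ z : ℂ, (z - lam)⁻¹ ^ 2 * (G * matResolvent M z).trace =
        ∑ i, ∑ j, G i j * ((z - lam)⁻¹ ^ 2 * matResolvent M z j i) := by
      intro z
      simp only [Matrix.trace, Matrix.diag, Matrix.mul_apply, Finset.mul_sum]
      exact Finset.sum_congr rfl fun i _ => Finset.sum_congr rfl fun j _ => by ring
    have h2 : ((Q * D * A * D).trace : ℂ) = (G * A.map Complex.ofReal).trace := by
      rw [hG, hDc, hQc, ← map_ofReal_mul, ← map_ofReal_mul, ← map_ofReal_mul, trace_map_ofReal,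
        Matrix.trace_mul_comm]
      simp only [mul_assoc]
    have hijG : ∀ i j, ContinuousOn
        (fun z : ℂ => G i j * ((z - lam)⁻¹ ^ 2 * matResolvent M z j i)) (Set.range γ) :=
      fun i j => continuousOn_const.mul (hij j i)
    simp only [h1]
    rw [h2, contourIntegral_sum _ hγ.regular fun i => continuousOn_finsetSum _ fun j _ =>
      hijG i j]
    simp only [Matrix.trace, Matrix.diag, Matrix.mul_apply, Finset.mul_sum]
    refine Finset.sum_congr rfl fun i _ => ?_
    rw [contourIntegral_sum _ hγ.regular fun j => hijG i j]
    refine Finset.sum_congr rfl fun j _ => ?_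
    rw [contourIntegral_const_mul,
      contourIntegral_inv_sq_mul_matResolvent hM hγ hNP hPA hNA]
    simp only [Matrix.map_apply]
    ring
  have hquadcont : ContinuousOn
      (fun z : ℂ => (z - lam)⁻¹ ^ 2 * (G * matResolvent M z).trace) (Set.range γ) :=
    (hqcont.pow 2).mul (htr.comp_continuousOn (continuousOn_const.mul hRcont))
  have hc1 : ContinuousOn (fun z : ℂ => (z - lam)⁻¹ * Qc.trace) (Set.range γ) :=
    hqcont.mul continuousOn_const
  have hc2 : ContinuousOn (fun z : ℂ => (z - lam)⁻¹ ^ 2 * (Qc * Dc).trace) (Set.range γ) :=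
    (hqcont.pow 2).mul continuousOn_const
  have hc12 : ContinuousOn (fun z : ℂ => (z - lam)⁻¹ * Qc.trace +
      (z - lam)⁻¹ ^ 2 * (Qc * Dc).trace) (Set.range γ) := hc1.add hc2
  have hc123 : ContinuousOn (fun z : ℂ => (z - lam)⁻¹ * Qc.trace +
      (z - lam)⁻¹ ^ 2 * (Qc * Dc).trace + (z - lam)⁻¹ ^ 2 * (G * matResolvent M z).trace)
      (Set.range γ) := hc12.add hquadcont
  -- Order zero vanishes because `lam` has winding number zero, order one because `(z - lam)⁻²` has
  -- a primitive.
  have hmain : contourIntegral (fun z => (Qc * matResolvent (M + D) z).trace) γ =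
      2 * Real.pi * Complex.I * ((Q * D * A * D).trace : ℝ) + contourIntegral rem γ := by
    rw [contourIntegral_congr (g := fun z => (((z - lam)⁻¹ * Qc.trace +
      (z - lam)⁻¹ ^ 2 * (Qc * Dc).trace) + (z - lam)⁻¹ ^ 2 * (G * matResolvent M z).trace) +
      rem z),
      contourIntegral_add hγ.regular hc123 hremcont,
      contourIntegral_add hγ.regular hc12 hquadcont,
      contourIntegral_add hγ.regular hc1 hc2, contourIntegral_mul_const,
      contourIntegral_mul_const, contourIntegral_inv_sub, hγ.index_lam,
      contourIntegral_inv_sub_sq hγ.regular hγ.avoids_lam, hquad]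
    · ring
    · intro z hz
      exact trace_mul_resolvent_expansion
        (sub_ne_zero.2 fun h => hγ.avoids_lam (h ▸ hz)) (hRr z hz) (hS z hz) (hQT z) (hTQ z)
  rw [trace_mul_rieszProj hγ.regular _ _ hScont, hmain, mul_add, inv_mul_cancel_left₀ hpi,
    add_sub_cancel_left, norm_mul]
  refine (mul_le_mul_of_nonneg_left (norm_contourIntegral_le hγ.regular hrembound)
    (norm_nonneg _)).trans (le_of_eq ?_)
  ring

end Expansion

/-! ### Measurability of the Riesz projection -/

section Measurability

variable {p : ℕ}

/-- The matrix whose entries are the coordinates of a vector indexed by pairs. -/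
def vecToMat (x : EuclideanSpace ℝ (Fin p × Fin p)) : Matrix (Fin p) (Fin p) ℝ :=
  Matrix.of fun i j => x (i, j)

theorem continuous_vecToMat : Continuous (vecToMat (p := p)) := by
  unfold vecToMat
  fun_prop

theorem vecToMat_add (x y : EuclideanSpace ℝ (Fin p × Fin p)) :
    vecToMat (x + y) = vecToMat x + vecToMat y := by
  ext; simp [vecToMat]

theorem vecToMat_smul (c : ℝ) (x : EuclideanSpace ℝ (Fin p × Fin p)) :
    vecToMat (c • x) = c • vecToMat x := by
  ext; simp [vecToMat]

/-- The inverse is the adjugate times the totalised inverse of the determinant, hence jointly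
measurable in matrix and parameter even where the contour meets the spectrum. No restriction to
matrices near `M` is needed. -/
theorem measurable_rieszProj_vecToMat {a : ℂ} (γ : Path a a) (i j : Fin p) :
    Measurable fun x : EuclideanSpace ℝ (Fin p × Fin p) => rieszProj γ (vecToMat x) i j := by
  simp only [rieszProj, Matrix.of_apply, contourIntegral_eq_intervalIntegral,
    intervalIntegral.integral_of_le zero_le_one]
  refine measurable_const.mul (StronglyMeasurable.measurable ?_)
  refine StronglyMeasurable.integral_prod_right (f := fun x t => deriv γ.extend t *
    (γ.extend t • (1 : Matrix (Fin p) (Fin p) ℂ) -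
      (vecToMat x).map Complex.ofReal : Matrix (Fin p) (Fin p) ℂ)⁻¹ i j) ?_
  refine Measurable.stronglyMeasurable ?_
  have hc : Continuous fun y : EuclideanSpace ℝ (Fin p × Fin p) × ℝ =>
      γ.extend y.2 • (1 : Matrix (Fin p) (Fin p) ℂ) - (vecToMat y.1).map Complex.ofReal :=
    ((γ.continuous_extend.comp continuous_snd).smul continuous_const).sub
      ((continuous_vecToMat.comp continuous_fst).matrix_map Complex.continuous_ofReal)
  have hadj := (continuous_apply_apply (ρ := fun _ _ => ℂ) i j).comp hc.matrix_adjugate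
  refine ((measurable_deriv _).comp measurable_snd).mul ?_
  simp only [Matrix.inv_def, Ring.inverse_eq_inv', Matrix.smul_apply, smul_eq_mul]
  exact hc.matrix_det.measurable.inv.mul hadj.measurable

end Measurability

/-! ### Conditional independence -/

section CondIndep

theorem projSigma_le_comap {Ω : Type*} {p : ℕ} (E : Submodule ℝ (EuclideanSpace ℝ (Fin p)))
    (Z : Ω → EuclideanSpace ℝ (Fin p)) :
    projSigma E Z ≤ MeasurableSpace.comap Z inferInstance := by
  rintro _ ⟨B, hB, rfl⟩
  exact ⟨E.starProjection ⁻¹' B, E.starProjection.continuous.measurable hB, rfl⟩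

theorem integrable_condExp_indicator_mul {Ω : Type*} [mΩ : MeasurableSpace Ω] {μ : Measure Ω}
    {m : MeasurableSpace Ω} (hm : m ≤ mΩ) (s : Set Ω)
    {g : Ω → ℝ} (hg : Integrable g μ) : Integrable (μ⟦s | m⟧ * g) μ := by
  refine hg.bdd_mul (c := 1) (stronglyMeasurable_condExp.mono hm).aestronglyMeasurable ?_
  have := ae_bdd_abs_condExp_of_ae_bdd_abs (m := m) (μ := μ) (R := 1)
    (f := s.indicator fun _ => (1 : ℝ)) (ae_of_all _ fun ω => by
      by_cases h : ω ∈ s <;> simp [h])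
  simpa using this

variable {Ω : Type*} [mΩ : MeasurableSpace Ω] {μ : Measure Ω} [IsProbabilityMeasure μ]

theorem integral_condExp_mul {m : MeasurableSpace Ω} (hm : m ≤ mΩ) {f g : Ω → ℝ}
    (hg : Integrable g μ) (hfg : Integrable (μ[f | m] * g) μ) :
    ∫ ω, (μ[f | m]) ω * g ω ∂μ = ∫ ω, (μ[f | m]) ω * (μ[g | m]) ω ∂μ := by
  rw [← integral_condExp hm]
  exact integral_congr_ae (condExp_mul_of_stronglyMeasurable_left stronglyMeasurable_condExp hfg hg)

variable {p : ℕ} {Z : Ω → EuclideanSpace ℝ (Fin p)} {Y : Ω → ℝ}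
  {E : Submodule ℝ (EuclideanSpace ℝ (Fin p))}

theorem projSigma_le (hZ : Measurable Z) : projSigma E Z ≤ mΩ :=
  (projSigma_le_comap E Z).trans hZ.comap_le

/-- Given `Z`, the event `Y ∈ A` has the same conditional probability as given `P_E Z`. -/
theorem IsDRS.condExp_comap_ae_eq (h : IsDRS μ Z Y E) (hZ : Measurable Z) (hY : Measurable Y)
    {A : Set ℝ} (hA : MeasurableSet A) :
    μ⟦Y ⁻¹' A | projSigma E Z⟧ =ᵐ[μ] μ⟦Y ⁻¹' A | MeasurableSpace.comap Z inferInstance⟧ := by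
  have hm := projSigma_le (E := E) hZ
  have hind : ∀ {s : Set Ω}, MeasurableSet s → Integrable (s.indicator fun _ => (1 : ℝ)) μ :=
    fun hs => (integrable_const 1).indicator hs
  refine ae_eq_condExp_of_forall_setIntegral_eq hZ.comap_le (hind (hY hA))
    (fun _ _ _ => integrable_condExp.integrableOn) ?_
    (stronglyMeasurable_condExp.mono (projSigma_le_comap E Z)).aestronglyMeasurable
  -- Integrated over `Z ∈ B`, the left side becomes the integral of a product of two conditional
  -- probabilities, which conditional independence turns into `μ(Y ∈ A, Z ∈ B)`.
  rintro _ ⟨B, hB, rfl⟩ -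
  have h1 : ∀ f : Ω → ℝ, ∫ ω in Z ⁻¹' B, f ω ∂μ =
      ∫ ω, f ω * (Z ⁻¹' B).indicator (fun _ => (1 : ℝ)) ω ∂μ := fun f => by
    rw [← integral_indicator (hZ hB)]
    congr 1; ext ω
    by_cases hω : ω ∈ Z ⁻¹' B <;> simp [hω]
  rw [h1, integral_condExp_mul hm (hind (hZ hB))
    (integrable_condExp_indicator_mul hm _ (hind (hZ hB))), ← integral_congr_ae (h A B hA hB),
    integral_condExp hm, h1]
  congr 1; ext ω
  by_cases h1 : ω ∈ Y ⁻¹' A <;> by_cases h2 : ω ∈ Z ⁻¹' B <;> simp_all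

/-- Conditioning on `Z` replaces the indicator of `Y ∈ A` by its conditional probability. This
depends on `P_E Z` only, so `F(Z)` may be replaced by its conditional mean, which is zero. -/
theorem IsDRS.setIntegral_eq_zero (h : IsDRS μ Z Y E) (hZ : Measurable Z) (hY : Measurable Y)
    {F : EuclideanSpace ℝ (Fin p) → ℝ} (hF : Measurable F)
    (hint : Integrable (fun ω => F (Z ω)) μ)
    (hF0 : μ[fun ω => F (Z ω) | projSigma E Z] =ᵐ[μ] 0) {A : Set ℝ} (hA : MeasurableSet A) :
    ∫ ω in Y ⁻¹' A, F (Z ω) ∂μ = 0 := by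
  have hm := projSigma_le (E := E) hZ
  have hind : Integrable ((Y ⁻¹' A).indicator fun _ => (1 : ℝ)) μ :=
    (integrable_const 1).indicator (hY hA)
  have hFm : StronglyMeasurable[MeasurableSpace.comap Z inferInstance] (fun ω => F (Z ω)) :=
    (hF.comp (comap_measurable Z)).stronglyMeasurable
  have h1 : ∫ ω in Y ⁻¹' A, F (Z ω) ∂μ =
      ∫ ω, ((Y ⁻¹' A).indicator (fun _ => (1 : ℝ)) * fun ω => F (Z ω)) ω ∂μ := by
    rw [← integral_indicator (hY hA)]
    congr 1; ext ω
    by_cases hω : ω ∈ Y ⁻¹' A <;> simp [hω]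
  have hprod : Integrable ((Y ⁻¹' A).indicator (fun _ => (1 : ℝ)) * fun ω => F (Z ω)) μ := by
    convert! hint.indicator (hY hA) using 1
    ext ω
    by_cases hω : ω ∈ Y ⁻¹' A <;> simp [hω]
  rw [h1, ← integral_condExp hZ.comap_le]
  calc _ = ∫ ω, (μ⟦Y ⁻¹' A | MeasurableSpace.comap Z inferInstance⟧) ω * F (Z ω) ∂μ :=
        integral_congr_ae (condExp_mul_of_stronglyMeasurable_right hFm hprod hind)
    _ = ∫ ω, (μ⟦Y ⁻¹' A | projSigma E Z⟧) ω * F (Z ω) ∂μ := by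
        refine integral_congr_ae ?_
        filter_upwards [h.condExp_comap_ae_eq hZ hY hA] with ω hω
        rw [hω]
    _ = ∫ ω, (μ⟦Y ⁻¹' A | projSigma E Z⟧) ω * (μ[fun ω => F (Z ω) | projSigma E Z]) ω ∂μ :=
        integral_condExp_mul hm hint (integrable_condExp_indicator_mul hm _ hint)
    _ = 0 := by
        rw [← integral_zero Ω ℝ]
        refine integral_congr_ae ?_
        filter_upwards [hF0] with ω hω
        simp [hω]

/-- If `Y` and `Z` are conditionally independent given `P_E Z` and `E[F(Z) | P_E Z] = 0`, then
`F(Z)` is orthogonal to every function of `Y`. -/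
theorem IsDRS.integral_mul_eq_zero (h : IsDRS μ Z Y E) (hZ : Measurable Z) (hY : Measurable Y)
    {F : EuclideanSpace ℝ (Fin p) → ℝ} (hF : Measurable F)
    (hint : Integrable (fun ω => F (Z ω)) μ)
    (hF0 : μ[fun ω => F (Z ω) | projSigma E Z] =ᵐ[μ] 0) {ψ : ℝ → ℝ} (hψ : Measurable ψ)
    (hprod : Integrable (fun ω => F (Z ω) * ψ (Y ω)) μ) :
    ∫ ω, F (Z ω) * ψ (Y ω) ∂μ = 0 := by
  -- The vanishing over all events `Y ∈ A` says `E[F(Z) | Y] = 0`. Pulling `ψ(Y)` out of this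
  -- conditional expectation treats unbounded `ψ` without approximation, given only that the product
  -- is integrable.
  have h0 : (0 : Ω → ℝ) =ᵐ[μ] μ[fun ω => F (Z ω) | MeasurableSpace.comap Y inferInstance] := by
    refine ae_eq_condExp_of_forall_setIntegral_eq hY.comap_le hint
      (fun _ _ _ => (integrable_zero Ω ℝ μ).integrableOn) ?_
      stronglyMeasurable_zero.aestronglyMeasurable
    rintro _ ⟨A, hA, rfl⟩ -
    rw [h.setIntegral_eq_zero hZ hY hF hint hF0 hA]
    simp
  have hψm : StronglyMeasurable[MeasurableSpace.comap Y inferInstance] (fun ω => ψ (Y ω)) :=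
    (hψ.comp (comap_measurable Y)).stronglyMeasurable
  rw [← integral_condExp hY.comap_le, ← integral_zero Ω ℝ]
  refine integral_congr_ae ?_
  filter_upwards [condExp_mul_of_stronglyMeasurable_right (m := MeasurableSpace.comap Y inferInstance) hψm hprod hint, h0] with ω h1 h2
  have h3 : (μ[fun ω => F (Z ω) * ψ (Y ω) | MeasurableSpace.comap Y inferInstance]) ω = _ := h1
  rw [h3, Pi.mul_apply, ← h2, Pi.zero_apply, zero_mul]

end CondIndep

/-! ### Multivariate central limit theorem -/

section CLT

open scoped RealInnerProductSpace

variable {Ω : Type*} [MeasurableSpace Ω] {μ : Measure Ω} [IsProbabilityMeasure μ]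
  {ι : Type*} [Fintype ι]

/-- Covariance matrix of a random vector. -/
def covMatrix (X : Ω → EuclideanSpace ℝ ι) (μ : Measure Ω) : Matrix ι ι ℝ :=
  Matrix.of fun i j => cov[fun ω => X ω i, fun ω => X ω j; μ]

theorem memLp_apply {Ω : Type*} [MeasurableSpace Ω] {μ : Measure Ω} {ι : Type*} [Fintype ι]
    {X : Ω → EuclideanSpace ℝ ι} (hX : MemLp X 2 μ) (i : ι) :
    MemLp (fun ω => X ω i) 2 μ :=
  (EuclideanSpace.proj (𝕜 := ℝ) i).comp_memLp' hX

theorem dotProduct_covMatrix_mulVec {X : Ω → EuclideanSpace ℝ ι} (hX : MemLp X 2 μ) (t : ι → ℝ) :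
    t ⬝ᵥ (covMatrix X μ).mulVec t = Var[fun ω => ∑ i, t i * X ω i; μ] := by
  rw [variance_fun_sum fun i => (memLp_apply hX i).const_mul (t i)]
  simp only [dotProduct, Matrix.mulVec, covMatrix, Matrix.of_apply, covariance_const_mul_left,
    covariance_const_mul_right, Finset.mul_sum]
  exact Finset.sum_congr rfl fun i _ => Finset.sum_congr rfl fun j _ => by ring

theorem posSemidef_covMatrix {X : Ω → EuclideanSpace ℝ ι} (hX : MemLp X 2 μ) :
    (covMatrix X μ).PosSemidef := by
  refine Matrix.PosSemidef.of_dotProduct_mulVec_nonneg ?_ fun t => ?_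
  · ext i j
    simp [covMatrix, covariance_comm]
  · rw [star_trivial, dotProduct_covMatrix_mulVec hX]
    exact variance_nonneg _ _

/-- Cramér–Wold by characteristic functions: the value at `t` for the vector sum is the value at `1`
for the scalar sum of the `⟪X k, t⟫`, to which the one-dimensional theorem applies. The limits agree
because `tᵀ Σ t` is the variance of `⟪X 0, t⟫`; a singular `Σ` is allowed. -/
theorem tendstoInDistribution_inv_sqrt_smul_sum_sub [DecidableEq ι]
    {X : ℕ → Ω → EuclideanSpace ℝ ι}
    (hX : MemLp (X 0) 2 μ) (hindep : iIndepFun X μ)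
    (hident : ∀ i, IdentDistrib (X i) (X 0) μ μ) :
    TendstoInDistribution
      (fun (n : ℕ) ω => (√(n : ℝ))⁻¹ • (∑ k ∈ Finset.range n, X k ω - (n : ℝ) • μ[X 0]))
      atTop id (fun _ => μ) (multivariateGaussian 0 (covMatrix (X 0) μ)) where
  forall_aemeasurable n := by
    have := fun k => (hident k).aemeasurable_fst
    fun_prop
  tendsto := by
    have hmeas := fun k => (hident k).aemeasurable_fst
    refine ProbabilityMeasure.tendsto_iff_tendsto_charFun.2 fun t => ?_
    have hL : Measurable fun x : EuclideanSpace ℝ ι => ⟪x, t⟫ := by fun_prop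
    have hX1 : Integrable (X 0) μ := hX.integrable (by norm_num)
    have hmean : ∫ ω, ⟪X 0 ω, t⟫ ∂μ = ⟪μ[X 0], t⟫ := by
      simp only [real_inner_comm t]
      exact integral_inner hX1 t
    have hLp : MemLp (fun ω => ⟪X 0 ω, t⟫) 2 μ := by
      simp only [real_inner_comm t]
      exact hX.const_inner t
    have hclt := tendstoInDistribution_inv_sqrt_mul_sum_sub (P := μ)
      (X := fun k ω => ⟪X k ω, t⟫)
      (P' := gaussianReal 0 Var[fun ω => ⟪X 0 ω, t⟫; μ].toNNReal) (Y := id) HasLaw.id hLp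
      (hindep.comp _ fun _ => hL) fun k => (hident k).comp hL
    have h1 := ProbabilityMeasure.tendsto_iff_tendsto_charFun.1 hclt.tendsto 1
    have hlim : charFun ((multivariateGaussian 0 (covMatrix (X 0) μ)).map id) t =
        charFun ((gaussianReal 0 Var[fun ω => ⟪X 0 ω, t⟫; μ].toNNReal).map id) 1 := by
      rw [Measure.map_id, Measure.map_id,
        charFun_multivariateGaussian (posSemidef_covMatrix hX), charFun_gaussianReal,
        dotProduct_covMatrix_mulVec hX]
      have : (fun ω => ∑ i, t i * X 0 ω i) = fun ω => ⟪X 0 ω, t⟫ := by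
        ext ω; simp [PiLp.inner_apply]
      rw [this, Real.coe_toNNReal _ (variance_nonneg _ _)]
      simp
    have hseq : ∀ n : ℕ, charFun (μ.map fun ω => (√(n : ℝ))⁻¹ •
          (∑ k ∈ Finset.range n, X k ω - (n : ℝ) • μ[X 0])) t =
        charFun (μ.map fun ω => (√(n : ℝ))⁻¹ *
          (∑ k ∈ Finset.range n, ⟪X k ω, t⟫ - n * ∫ ω, ⟪X 0 ω, t⟫ ∂μ)) 1 := by
      intro n
      have hA : AEMeasurable (fun ω => (√(n : ℝ))⁻¹ •
          (∑ k ∈ Finset.range n, X k ω - (n : ℝ) • μ[X 0])) μ := by fun_prop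
      rw [charFun_apply, charFun_apply_real, integral_map hA (by fun_prop),
        integral_map (by fun_prop) (by fun_prop)]
      congr 1; ext ω
      rw [hmean, real_inner_smul_left, inner_sub_left, sum_inner, real_inner_smul_left]
      simp
    simp only [ProbabilityMeasure.coe_mk] at h1 ⊢
    rw [hlim]
    exact h1.congr fun n => (hseq n).symm

end CLT

/-! ### Projection matrices -/

section Projection

variable {p : ℕ} (E : Submodule ℝ (EuclideanSpace ℝ (Fin p)))

theorem toEuclideanCLM_projMatrix :
    Matrix.toEuclideanCLM (n := Fin p) (𝕜 := ℝ) (projMatrix E) = E.starProjection :=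
  StarAlgEquiv.apply_symm_apply _ _

theorem projMatrix_mul_self : projMatrix E * projMatrix E = projMatrix E := by
  apply EquivLike.injective (Matrix.toEuclideanCLM (n := Fin p) (𝕜 := ℝ))
  rw [map_mul, toEuclideanCLM_projMatrix]
  exact E.isIdempotentElem_starProjection

theorem transpose_projMatrix : (projMatrix E).transpose = projMatrix E := by
  have : star (projMatrix E) = projMatrix E := by
    apply EquivLike.injective (Matrix.toEuclideanCLM (n := Fin p) (𝕜 := ℝ))
    rw [map_star, toEuclideanCLM_projMatrix]
    exact isSelfAdjoint_starProjection E
  simpa [Matrix.star_eq_conjTranspose] using this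

theorem projMatrix_orthogonal : projMatrix Eᗮ = 1 - projMatrix E := by
  apply EquivLike.injective (Matrix.toEuclideanCLM (n := Fin p) (𝕜 := ℝ))
  rw [map_sub, map_one, toEuclideanCLM_projMatrix, toEuclideanCLM_projMatrix,
    E.starProjection_orthogonal']

theorem starProjection_apply_eq_sum (z : EuclideanSpace ℝ (Fin p)) (i : Fin p) :
    E.starProjection z i = ∑ j, projMatrix E i j * z j := by
  rw [← toEuclideanCLM_projMatrix, Matrix.ofLp_toEuclideanCLM]
  rfl

theorem trace_projMatrix : (projMatrix E).trace = Module.finrank ℝ E := by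
  have hproj : LinearMap.IsProj E (E.starProjection : _ →ₗ[ℝ] EuclideanSpace ℝ (Fin p)) :=
    ⟨fun x => E.starProjection_apply_mem x, fun x hx => E.starProjection_eq_self_iff.2 hx⟩
  rw [← hproj.trace, LinearMap.trace_eq_sum_inner _ (EuclideanSpace.basisFun (Fin p) ℝ)]
  refine Finset.sum_congr rfl fun i _ => ?_
  simp [starProjection_apply_eq_sum, EuclideanSpace.inner_single_left]

theorem mem_of_projMatrix_mulVec {v : Fin p → ℝ} (hv : (projMatrix E).mulVec v = v) :
    WithLp.toLp 2 v ∈ E := by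
  rw [← E.starProjection_eq_self_iff, ← toEuclideanCLM_projMatrix, Matrix.toEuclideanCLM_toLp, hv]

end Projection

/-! ### Inverse of a symmetric matrix on its range -/

section InvOnRange

variable {p : ℕ} {E : Submodule ℝ (EuclideanSpace ℝ (Fin p))} {M : Matrix (Fin p) (Fin p) ℝ}
  {lam : ℝ}

theorem mul_one_sub_projMatrix (hM : M.transpose = M)
    (hQM : (1 - projMatrix E) * M = lam • (1 - projMatrix E)) :
    M * (1 - projMatrix E) = lam • (1 - projMatrix E) := by
  have := congrArg Matrix.transpose hQM
  simpa [Matrix.transpose_mul, Matrix.transpose_sub, hM, transpose_projMatrix] using this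

theorem sub_smul_one_mul_projMatrix (hM : M.transpose = M)
    (hQM : (1 - projMatrix E) * M = lam • (1 - projMatrix E)) :
    (M - lam • 1) * projMatrix E = M - lam • 1 := by
  have h1 := mul_one_sub_projMatrix hM hQM
  have h2 : (M - lam • 1) * (1 - projMatrix E) = 0 := by
    rw [sub_mul, h1, Matrix.smul_mul, one_mul, sub_self]
  rw [mul_sub, mul_one, sub_eq_zero] at h2
  exact h2.symm

theorem projMatrix_mul_sub_smul_one
    (hQM : (1 - projMatrix E) * M = lam • (1 - projMatrix E)) :
    projMatrix E * (M - lam • 1) = M - lam • 1 := by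
  have h2 : (1 - projMatrix E) * (M - lam • 1) = 0 := by
    rw [mul_sub, hQM, Matrix.mul_smul, mul_one, sub_self]
  rw [sub_mul, one_mul, sub_eq_zero] at h2
  exact h2.symm

/-- A kernel vector `v` of the sum lies in `E` and in the kernel of `N`. As `E` is the range of the
symmetric `N`, `v = N w` and `v · v = (N v) · w = 0`. -/
theorem isUnit_sub_smul_one_add (hM : M.transpose = M)
    (hQM : (1 - projMatrix E) * M = lam • (1 - projMatrix E))
    (hE : LinearMap.range (Matrix.toEuclideanLin (M - lam • (1 : Matrix (Fin p) (Fin p) ℝ))) = E) :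
    IsUnit (M - lam • 1 + (1 - projMatrix E)) := by
  have hPN := projMatrix_mul_sub_smul_one hQM
  have hP := projMatrix_mul_self E
  set P := projMatrix E with hPdef
  set N := M - lam • (1 : Matrix (Fin p) (Fin p) ℝ) with hN
  have hNt : N.transpose = N := by
    rw [hN, Matrix.transpose_sub, Matrix.transpose_smul, Matrix.transpose_one, hM]
  rw [← Matrix.mulVec_injective_iff_isUnit]
  refine (injective_iff_map_eq_zero (Matrix.mulVecLin (N + (1 - P)))).2 fun v hv => ?_
  have hv' : (N + (1 - P)).mulVec v = 0 := hv
  have hQv : (1 - P).mulVec v = 0 := by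
    have h := congrArg (1 - P).mulVec hv'
    have e : (1 - P) * (N + (1 - P)) = 1 - P := by
      rw [mul_add, sub_mul, one_mul, hPN, mul_sub, mul_one, sub_mul, one_mul, hP]; simp
    rwa [Matrix.mulVec_mulVec, e, Matrix.mulVec_zero] at h
  have hNv : N.mulVec v = 0 := by
    rwa [Matrix.add_mulVec, hQv, add_zero] at hv'
  have hPv : P.mulVec v = v := by
    rw [Matrix.sub_mulVec, Matrix.one_mulVec, sub_eq_zero] at hQv
    exact hQv.symm
  have hmem := mem_of_projMatrix_mulVec E hPv
  rw [← hE] at hmem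
  obtain ⟨w, hw⟩ := hmem
  have hw' : N.mulVec w.ofLp = v := congrArg WithLp.ofLp hw
  have hvv : v ⬝ᵥ v = 0 := by
    nth_rewrite 2 [← hw']
    rw [Matrix.dotProduct_mulVec, ← Matrix.mulVec_transpose, hNt, hNv, zero_dotProduct]
  exact dotProduct_self_eq_zero.1 hvv

/-- The squared inverse of the restriction of `M - lam I` to `E`, extended by zero. -/
def sqInvOnRange (E : Submodule ℝ (EuclideanSpace ℝ (Fin p))) (M : Matrix (Fin p) (Fin p) ℝ)
    (lam : ℝ) : Matrix (Fin p) (Fin p) ℝ :=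
  projMatrix E * invOnRange (projMatrix E) (projMatrix E * M - lam • 1) ^ 2

theorem projMatrix_mul_sqInvOnRange : projMatrix E * sqInvOnRange E M lam = sqInvOnRange E M lam := by
  rw [sqInvOnRange, ← mul_assoc, projMatrix_mul_self]

/-- Both `N P` and `P N` equal `N`, so compressing `P M - lam I` to `E` gives `N` itself. -/
theorem invOnRange_eq (hM : M.transpose = M)
    (hQM : (1 - projMatrix E) * M = lam • (1 - projMatrix E)) :
    invOnRange (projMatrix E) (projMatrix E * M - lam • 1) =
      (M - lam • 1 + (1 - projMatrix E))⁻¹ := by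
  have hNP := sub_smul_one_mul_projMatrix hM hQM
  have hPN := projMatrix_mul_sub_smul_one hQM
  have hP := projMatrix_mul_self E
  rw [invOnRange]
  congr 2
  calc _ = projMatrix E * ((M - lam • 1) * projMatrix E) := by
        rw [mul_sub, sub_mul, sub_mul, mul_sub, ← mul_assoc, hP, Matrix.mul_smul, Matrix.smul_mul,
          Matrix.smul_mul, Matrix.mul_smul, mul_one, one_mul, hP, mul_assoc]
    _ = _ := by rw [hNP, hPN]

/-- These relations say that the inverse is block diagonal for `E ⊕ E^⊥`: inverse of `N` on `E`,
identity on `E^⊥`. -/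
theorem sub_smul_one_mul_invOnRange (hM : M.transpose = M)
    (hQM : (1 - projMatrix E) * M = lam • (1 - projMatrix E))
    (hE : LinearMap.range (Matrix.toEuclideanLin (M - lam • (1 : Matrix (Fin p) (Fin p) ℝ))) = E) :
    (M - lam • 1) * invOnRange (projMatrix E) (projMatrix E * M - lam • 1) = projMatrix E ∧
    (1 - projMatrix E) * invOnRange (projMatrix E) (projMatrix E * M - lam • 1) =
      1 - projMatrix E ∧
    invOnRange (projMatrix E) (projMatrix E * M - lam • 1) * projMatrix E =
      projMatrix E * invOnRange (projMatrix E) (projMatrix E * M - lam • 1) := by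
  have hNP := sub_smul_one_mul_projMatrix hM hQM
  have hPN := projMatrix_mul_sub_smul_one hQM
  have hP := projMatrix_mul_self E
  have hdet := (Matrix.isUnit_iff_isUnit_det _).1 (isUnit_sub_smul_one_add hM hQM hE)
  rw [invOnRange_eq hM hQM]
  set P := projMatrix E
  set N := M - lam • (1 : Matrix (Fin p) (Fin p) ℝ)
  have h1 := Matrix.mul_nonsing_inv _ hdet
  have h2 := Matrix.nonsing_inv_mul _ hdet
  set B := (N + (1 - P))⁻¹
  have e1 : P * (N + (1 - P)) = N := by rw [mul_add, hPN, mul_sub, mul_one, hP]; simp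
  have e2 : (N + (1 - P)) * P = N := by rw [add_mul, hNP, sub_mul, one_mul, hP]; simp
  have hNB : N * B = P := by rw [← e1, mul_assoc, h1, mul_one]
  have hBN : B * N = P := by rw [← e2, ← mul_assoc, h2, one_mul]
  refine ⟨hNB, ?_, ?_⟩
  · rw [add_mul, hNB] at h1
    exact eq_sub_of_add_eq' h1
  · calc B * P = B * (N * B) := by rw [hNB]
      _ = P * B := by rw [← mul_assoc, hBN]

theorem sub_smul_one_sq_mul_sqInvOnRange (hM : M.transpose = M)
    (hQM : (1 - projMatrix E) * M = lam • (1 - projMatrix E))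
    (hE : LinearMap.range (Matrix.toEuclideanLin (M - lam • (1 : Matrix (Fin p) (Fin p) ℝ))) = E) :
    (M - lam • 1) * (M - lam • 1) * sqInvOnRange E M lam = projMatrix E := by
  have hNP := sub_smul_one_mul_projMatrix hM hQM
  obtain ⟨h1, -, -⟩ := sub_smul_one_mul_invOnRange hM hQM hE
  rw [sqInvOnRange, pow_two]
  set B := invOnRange (projMatrix E) (projMatrix E * M - lam • 1)
  set N := M - lam • (1 : Matrix (Fin p) (Fin p) ℝ)
  calc _ = N * (N * projMatrix E * B) * B := by simp only [mul_assoc]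
    _ = _ := by rw [hNP, h1, hNP, h1]

/-- From `Q M = lam Q`, `P M - lam I = N - lam Q` is block diagonal with blocks `N` on `E` and
`-lam` on `E^⊥`. Its inverse is `B P - lam⁻¹ Q`, and left multiplication by `P` discards the second
block. -/
theorem isUnit_and_projMatrix_mul_inv_sq (hM : M.transpose = M)
    (hQM : (1 - projMatrix E) * M = lam • (1 - projMatrix E))
    (hE : LinearMap.range (Matrix.toEuclideanLin (M - lam • (1 : Matrix (Fin p) (Fin p) ℝ))) = E)
    (hlam : lam ≠ 0) :
    IsUnit (projMatrix E * M - lam • 1) ∧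
      projMatrix E * (projMatrix E * M - lam • 1)⁻¹ ^ 2 = sqInvOnRange E M lam := by
  have hNP := sub_smul_one_mul_projMatrix hM hQM
  have hP := projMatrix_mul_self E
  obtain ⟨h1, h2, h3⟩ := sub_smul_one_mul_invOnRange hM hQM hE
  have hT : projMatrix E * M - lam • 1 =
      (M - lam • 1) - lam • (1 - projMatrix E) := by
    rw [← hQM, sub_mul, one_mul]; abel
  rw [sqInvOnRange]
  set B := invOnRange (projMatrix E) (projMatrix E * M - lam • 1)
  rw [hT]
  set P := projMatrix E
  set N := M - lam • (1 : Matrix (Fin p) (Fin p) ℝ)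
  set Q := 1 - P with hQ
  have hQP : Q * P = 0 := by rw [hQ, sub_mul, one_mul, hP, sub_self]
  have hPQ : P * Q = 0 := by rw [hQ, mul_sub, mul_one, hP, sub_self]
  have hQQ : Q * Q = Q := by nth_rewrite 2 [hQ]; rw [mul_sub, mul_one, hQP, sub_zero]
  have hNQ : N * Q = 0 := by rw [← hNP, mul_assoc, hPQ, mul_zero]
  have hmul : (N - lam • Q) * (B * P - lam⁻¹ • Q) = 1 := by
    clear_value N
    rw [mul_sub, sub_mul, sub_mul, ← mul_assoc, h1, hP, Matrix.smul_mul, ← mul_assoc, h2, hQP,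
      Matrix.mul_smul, hNQ, Matrix.smul_mul, Matrix.mul_smul, hQQ, smul_smul,
      mul_inv_cancel₀ hlam, one_smul, hQ]
    simp
  refine ⟨IsUnit.of_mul_eq_one _ hmul, ?_⟩
  rw [Matrix.inv_eq_right_inv hmul, pow_two, pow_two]
  have e1 : P * (B * P - lam⁻¹ • Q) = P * B := by
    rw [mul_sub, Matrix.mul_smul, hPQ, h3, ← mul_assoc, hP, smul_zero, sub_zero]
  have e2 : B * Q = Q := by rw [hQ, mul_sub, mul_one, h3, ← one_sub_mul, ← hQ, h2]
  calc P * ((B * P - lam⁻¹ • Q) * (B * P - lam⁻¹ • Q))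
      = P * B * (B * P - lam⁻¹ • Q) := by rw [← mul_assoc, e1]
    _ = P * (B * B * P) := by
        rw [mul_sub, Matrix.mul_smul, mul_assoc P B Q, e2, hPQ, smul_zero, sub_zero]
        simp only [mul_assoc]
    _ = P * (B * B) := by
        rw [mul_assoc B B P, h3, ← mul_assoc B P B, h3, ← mul_assoc, ← mul_assoc, hP, mul_assoc]

end InvOnRange

/-! ### Structure of the matrix `M_ψ` -/

section PsiMatrix

variable {Ω : Type*} [mΩ : MeasurableSpace Ω] {μ : Measure Ω}
  {p : ℕ} {Z : Ω → EuclideanSpace ℝ (Fin p)} {Y : Ω → ℝ}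
  {E : Submodule ℝ (EuclideanSpace ℝ (Fin p))} {ψ : ℝ → ℝ}

theorem memLp_clm_apply (hZ2 : MemLp Z 2 μ)
    (S : EuclideanSpace ℝ (Fin p) →L[ℝ] EuclideanSpace ℝ (Fin p)) (i : Fin p) :
    MemLp (fun ω => S (Z ω) i) 2 μ :=
  memLp_apply (S.comp_memLp' hZ2) i

theorem integrable_clm_apply_mul (hZ2 : MemLp Z 2 μ)
    (S T : EuclideanSpace ℝ (Fin p) →L[ℝ] EuclideanSpace ℝ (Fin p)) (i j : Fin p) :
    Integrable (fun ω => S (Z ω) i * T (Z ω) j) μ :=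
  (memLp_clm_apply hZ2 S i).integrable_mul (memLp_clm_apply hZ2 T j)

theorem stronglyMeasurable_starProjection_apply {Ω : Type*} (Z : Ω → EuclideanSpace ℝ (Fin p)) (j : Fin p) :
    StronglyMeasurable[projSigma E Z] (fun ω => E.starProjection (Z ω) j) := by
  refine Measurable.stronglyMeasurable ?_
  exact (show Measurable fun x : EuclideanSpace ℝ (Fin p) => x j by fun_prop).comp
    (comap_measurable fun ω => E.starProjection (Z ω))

theorem memLp_mul_mul (hZ : Measurable Z) (hY : Measurable Y) (hψ : Measurable ψ)
    (hmom : MemLp (fun ω => ‖Z ω‖ ^ 2 * ψ (Y ω)) 2 μ) (i j : Fin p) :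
    MemLp (fun ω => Z ω i * Z ω j * ψ (Y ω)) 2 μ := by
  refine hmom.mono (by fun_prop) (ae_of_all _ fun ω => ?_)
  rw [norm_mul, norm_mul, norm_mul, norm_pow, norm_norm, pow_two]
  gcongr
  · exact PiLp.norm_apply_le _ _
  · exact PiLp.norm_apply_le _ _

theorem transpose_psiMatrix : (psiMatrix μ Z Y ψ).transpose = psiMatrix μ Z Y ψ := by
  ext i j
  simp only [psiMatrix, Matrix.transpose_apply, Matrix.of_apply]
  congr 1; ext ω; ring

variable [IsProbabilityMeasure μ]

theorem condExp_starProjection_orthogonal_apply (hZ2 : MemLp Z 2 μ)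
    (hlin : LinearityCondition μ Z E) (i : Fin p) :
    μ[fun ω => Eᗮ.starProjection (Z ω) i | projSigma E Z] =ᵐ[μ] 0 := by
  have hint : Integrable Z μ := hZ2.integrable (by norm_num)
  have h := ((EuclideanSpace.proj (𝕜 := ℝ) i).comp Eᗮ.starProjection).comp_condExp_comm
    (m := projSigma E Z) hint
  filter_upwards [h, hlin] with ω h1 h2
  have h3 : (μ[fun ω => Eᗮ.starProjection (Z ω) i | projSigma E Z]) ω = _ := h1.symm
  rw [h3]
  simp [h2]

/-- In `Z = P Z + Q Z` the first term is measurable for the conditioning and the second has zero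
conditional mean. Consequently the centred vector in `condCovMatrix` is `Q Z`. -/
theorem condExp_apply_ae_eq (hZ : Measurable Z) (hZ2 : MemLp Z 2 μ)
    (hlin : LinearityCondition μ Z E) (i : Fin p) :
    μ[fun ω => Z ω i | projSigma E Z] =ᵐ[μ] fun ω => E.starProjection (Z ω) i := by
  have hm := projSigma_le (E := E) hZ
  have hP : Integrable (fun ω => E.starProjection (Z ω) i) μ :=
    (memLp_clm_apply hZ2 _ i).integrable (by norm_num)
  have hQ : Integrable (fun ω => Eᗮ.starProjection (Z ω) i) μ :=
    (memLp_clm_apply hZ2 _ i).integrable (by norm_num)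
  have h : (fun ω => Z ω i) = (fun ω => E.starProjection (Z ω) i) +
      fun ω => Eᗮ.starProjection (Z ω) i := by
    ext ω
    simp [E.starProjection_orthogonal']
  rw [h]
  filter_upwards [condExp_add hP hQ (projSigma E Z),
    condExp_starProjection_orthogonal_apply hZ2 hlin i] with ω h1 h2
  rw [h1, Pi.add_apply, h2, condExp_of_stronglyMeasurable hm
    (stronglyMeasurable_starProjection_apply Z i) hP]
  simp

theorem condExp_mul_starProjection (hZ2 : MemLp Z 2 μ)
    (hlin : LinearityCondition μ Z E) (i j : Fin p) :
    μ[fun ω => Eᗮ.starProjection (Z ω) i * E.starProjection (Z ω) j | projSigma E Z]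
      =ᵐ[μ] 0 := by
  have h := condExp_mul_of_stronglyMeasurable_right (μ := μ)
    (stronglyMeasurable_starProjection_apply (E := E) Z j)
    (integrable_clm_apply_mul hZ2 Eᗮ.starProjection E.starProjection i j)
    ((memLp_clm_apply hZ2 Eᗮ.starProjection i).integrable (by norm_num))
  filter_upwards [h, condExp_starProjection_orthogonal_apply hZ2 hlin i] with ω h1 h2
  have h3 : (μ[fun ω => Eᗮ.starProjection (Z ω) i * E.starProjection (Z ω) j |
    projSigma E Z]) ω = _ := h1
  rw [h3, Pi.mul_apply, h2]
  simp

theorem condExp_mul_starProjection_orthogonal (hZ : Measurable Z) (hZ2 : MemLp Z 2 μ)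
    (hlin : LinearityCondition μ Z E) {lam : Ω → ℝ}
    (hlam : ∀ᵐ ω ∂μ, condCovMatrix (projSigma E Z) μ Z ω = lam ω • (1 - projMatrix E))
    (i j : Fin p) :
    μ[fun ω => Eᗮ.starProjection (Z ω) i * Eᗮ.starProjection (Z ω) j | projSigma E Z]
      =ᵐ[μ] fun ω => lam ω * projMatrix Eᗮ i j := by
  have h : (fun ω => (Z ω i - (μ[fun ω => Z ω i | projSigma E Z]) ω) *
        (Z ω j - (μ[fun ω => Z ω j | projSigma E Z]) ω)) =ᵐ[μ]
      fun ω => Eᗮ.starProjection (Z ω) i * Eᗮ.starProjection (Z ω) j := by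
    filter_upwards [condExp_apply_ae_eq hZ hZ2 hlin i, condExp_apply_ae_eq hZ hZ2 hlin j]
      with ω h1 h2
    rw [h1, h2, E.starProjection_orthogonal']
    simp
  filter_upwards [condExp_congr_ae (m := projSigma E Z) h, hlam] with ω h1 h2
  rw [← h1, projMatrix_orthogonal]
  simpa [condCovMatrix] using congrFun (congrFun h2 i) j

theorem integrable_clm_mul_clm_mul (hZ : Measurable Z) (hY : Measurable Y) (hψ : Measurable ψ)
    (hmom : MemLp (fun ω => ‖Z ω‖ ^ 2 * ψ (Y ω)) 2 μ)
    (S T : EuclideanSpace ℝ (Fin p) →L[ℝ] EuclideanSpace ℝ (Fin p)) (i j : Fin p) :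
    Integrable (fun ω => S (Z ω) i * T (Z ω) j * ψ (Y ω)) μ := by
  have hint : Integrable (fun ω => ‖Z ω‖ ^ 2 * ψ (Y ω)) μ := hmom.integrable (by norm_num)
  refine (hint.norm.const_mul (‖S‖ * ‖T‖)).mono' (by fun_prop) (ae_of_all _ fun ω => ?_)
  rw [norm_mul, norm_mul, norm_mul, norm_pow, norm_norm]
  calc ‖S (Z ω) i‖ * ‖T (Z ω) j‖ * ‖ψ (Y ω)‖
      ≤ (‖S‖ * ‖Z ω‖) * (‖T‖ * ‖Z ω‖) * ‖ψ (Y ω)‖ := by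
        gcongr
        · exact (PiLp.norm_apply_le _ _).trans (S.le_opNorm _)
        · exact (PiLp.norm_apply_le _ _).trans (T.le_opNorm _)
    _ = _ := by ring

/-- Gives the blocks of `M_ψ` for the decomposition `E ⊕ E^⊥` as expectations, to which the
orthogonality of `F(Z)` and `ψ(Y)` applies. -/
theorem projMatrix_mul_psiMatrix_mul (hZ : Measurable Z) (hY : Measurable Y) (hψ : Measurable ψ)
    (hmom : MemLp (fun ω => ‖Z ω‖ ^ 2 * ψ (Y ω)) 2 μ)
    (F G : Submodule ℝ (EuclideanSpace ℝ (Fin p))) (i j : Fin p) :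
    (projMatrix F * psiMatrix μ Z Y ψ * projMatrix G) i j =
      ∫ ω, F.starProjection (Z ω) i * G.starProjection (Z ω) j * ψ (Y ω) ∂μ := by
  have hint : ∀ k l, Integrable (fun ω => Z ω k * Z ω l * ψ (Y ω)) μ := fun k l =>
    (memLp_mul_mul hZ hY hψ hmom k l).integrable (by norm_num)
  have h : ∀ ω, F.starProjection (Z ω) i * G.starProjection (Z ω) j * ψ (Y ω) =
      ∑ l, ∑ k, projMatrix F i k * projMatrix G l j * (Z ω k * Z ω l * ψ (Y ω)) := by
    intro ω
    have hG : ∀ l, projMatrix G l j = projMatrix G j l := fun l => by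
      conv_lhs => rw [← transpose_projMatrix, Matrix.transpose_apply]
    simp only [starProjection_apply_eq_sum, Finset.sum_mul, Finset.mul_sum, hG]
    exact Finset.sum_congr rfl fun l _ => Finset.sum_congr rfl fun k _ => by ring
  simp only [h]
  rw [integral_finsetSum _ fun l _ => integrable_finsetSum _ fun k _ => (hint k l).const_mul _]
  rw [Matrix.mul_apply]
  refine Finset.sum_congr rfl fun l _ => ?_
  rw [integral_finsetSum _ fun k _ => (hint k l).const_mul _, Matrix.mul_apply, Finset.sum_mul]
  refine Finset.sum_congr rfl fun k _ => ?_
  rw [integral_const_mul, psiMatrix, Matrix.of_apply]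
  ring

/-- Under the linearity and the diagonal conditional variance conditions, the orthogonal
complement of a dimension reduction subspace consists of eigenvectors of `M_ψ`. -/
theorem one_sub_projMatrix_mul_psiMatrix (h : IsDRS μ Z Y E) (hd : Module.finrank ℝ E < p)
    (hZ : Measurable Z) (hY : Measurable Y) (hZ2 : MemLp Z 2 μ)
    (hlin : LinearityCondition μ Z E) (hdcv : DiagonalCondVar μ Z E) (hψ : Measurable ψ)
    (hmom : MemLp (fun ω => ‖Z ω‖ ^ 2 * ψ (Y ω)) 2 μ) :
    (1 - projMatrix E) * psiMatrix μ Z Y ψ = psiLambda μ Z Y ψ E • (1 - projMatrix E) := by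
  obtain ⟨lam, -, hlam⟩ := hdcv
  -- Off-diagonal block: `(Qz)_i (Pz)_j` has zero conditional mean by the linearity condition.
  have hQP : projMatrix Eᗮ * psiMatrix μ Z Y ψ * projMatrix E = 0 := by
    ext i j
    rw [projMatrix_mul_psiMatrix_mul hZ hY hψ hmom]
    exact h.integral_mul_eq_zero hZ hY
      (F := fun z => Eᗮ.starProjection z i * E.starProjection z j) (by fun_prop)
      (integrable_clm_apply_mul hZ2 _ _ i j) (condExp_mul_starProjection hZ2 hlin i j) hψ
      (integrable_clm_mul_clm_mul hZ hY hψ hmom _ _ i j)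
  have hpos : (p : ℝ) - Module.finrank ℝ E ≠ 0 :=
    (sub_pos.2 (by exact_mod_cast hd : (Module.finrank ℝ E : ℝ) < p)).ne'
  have htrace : ∑ k, projMatrix Eᗮ k k = (p : ℝ) - Module.finrank ℝ E := by
    have : (projMatrix Eᗮ).trace = (p : ℝ) - Module.finrank ℝ E := by
      rw [projMatrix_orthogonal, Matrix.trace_sub, trace_projMatrix]
      simp
    exact this
  have hnorm : ∀ z : EuclideanSpace ℝ (Fin p), ‖Eᗮ.starProjection z‖ ^ 2 =
      ∑ k, Eᗮ.starProjection z k * Eᗮ.starProjection z k := fun z => by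
    rw [EuclideanSpace.real_norm_sq_eq]
    simp only [pow_two]
  set r := ((p : ℝ) - Module.finrank ℝ E)⁻¹ with hr
  have hQQ : projMatrix Eᗮ * psiMatrix μ Z Y ψ * projMatrix Eᗮ =
      psiLambda μ Z Y ψ E • projMatrix Eᗮ := by
    ext i j
    rw [projMatrix_mul_psiMatrix_mul hZ hY hψ hmom]
    -- With `c = Q_ij / (p - d)` the conditional mean of `(Qz)_i (Qz)_j - c ‖Qz‖²` is `lam(ω) (Q_ij
    -- - c tr Q)`, which is zero since `tr Q = p - d`. The random factor `lam(ω)` thus drops out.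
    set c := projMatrix Eᗮ i j * r with hc
    have hint1 := integrable_clm_apply_mul (μ := μ) hZ2 Eᗮ.starProjection Eᗮ.starProjection i j
    have hint2 : ∀ k, Integrable (fun ω => Eᗮ.starProjection (Z ω) k *
      Eᗮ.starProjection (Z ω) k) μ := fun k => integrable_clm_apply_mul hZ2 _ _ k k
    have hint3 : Integrable (fun ω => c * ‖Eᗮ.starProjection (Z ω)‖ ^ 2) μ := by
      simp only [hnorm]
      exact (integrable_finsetSum _ fun k _ => hint2 k).const_mul c
    have hint4 := integrable_clm_mul_clm_mul (μ := μ) hZ hY hψ hmom Eᗮ.starProjection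
      Eᗮ.starProjection
    have hint5 : Integrable (fun ω => c * (‖Eᗮ.starProjection (Z ω)‖ ^ 2 * ψ (Y ω))) μ := by
      simp only [hnorm, Finset.sum_mul]
      exact (integrable_finsetSum _ fun k _ => hint4 k k).const_mul c
    have hF0 : μ[fun ω => Eᗮ.starProjection (Z ω) i * Eᗮ.starProjection (Z ω) j -
        c * ‖Eᗮ.starProjection (Z ω)‖ ^ 2 | projSigma E Z] =ᵐ[μ] 0 := by
      have e1 := condExp_sub hint1 hint3 (projSigma E Z)
      have e2 := condExp_mul_starProjection_orthogonal hZ hZ2 hlin hlam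
      have e3 : μ[fun ω => c * ‖Eᗮ.starProjection (Z ω)‖ ^ 2 | projSigma E Z] =ᵐ[μ]
          fun ω => c * ∑ k, lam ω * projMatrix Eᗮ k k := by
        have e4 : (fun ω => c * ‖Eᗮ.starProjection (Z ω)‖ ^ 2) =
            c • ∑ k, fun ω => Eᗮ.starProjection (Z ω) k * Eᗮ.starProjection (Z ω) k := by
          ext ω; simp only [Pi.smul_apply, Finset.sum_apply, smul_eq_mul, hnorm]
        rw [e4]
        filter_upwards [condExp_smul (μ := μ) c (∑ k, fun ω => Eᗮ.starProjection (Z ω) k *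
            Eᗮ.starProjection (Z ω) k) (projSigma E Z),
          condExp_finsetSum (s := Finset.univ) (fun k _ => hint2 k) (projSigma E Z),
          ae_all_iff.2 fun k => e2 k k] with ω h1 h2 h3
        rw [h1, Pi.smul_apply, h2, Finset.sum_apply, smul_eq_mul]
        simp only [h3]
      filter_upwards [e1, e2 i j, e3] with ω h1 h2 h3
      have h4 : (μ[fun ω => Eᗮ.starProjection (Z ω) i * Eᗮ.starProjection (Z ω) j -
        c * ‖Eᗮ.starProjection (Z ω)‖ ^ 2 | projSigma E Z]) ω = _ := h1
      rw [h4, Pi.sub_apply, h2, h3, ← Finset.mul_sum, htrace, hc, hr]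
      simp only [Pi.zero_apply]
      field_simp
      ring
    have h0 := h.integral_mul_eq_zero hZ hY
      (F := fun z => Eᗮ.starProjection z i * Eᗮ.starProjection z j -
        c * ‖Eᗮ.starProjection z‖ ^ 2) (by fun_prop) (hint1.sub hint3) hF0 hψ (by
          convert! (hint4 i j).sub hint5 using 1
          ext ω; simp; ring)
    have h1 : ∫ ω, (Eᗮ.starProjection (Z ω) i * Eᗮ.starProjection (Z ω) j -
        c * ‖Eᗮ.starProjection (Z ω)‖ ^ 2) * ψ (Y ω) ∂μ =
        ∫ ω, Eᗮ.starProjection (Z ω) i * Eᗮ.starProjection (Z ω) j * ψ (Y ω) ∂μ -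
        ∫ ω, c * (‖Eᗮ.starProjection (Z ω)‖ ^ 2 * ψ (Y ω)) ∂μ := by
      rw [← integral_sub (hint4 i j) hint5]
      congr 1; ext ω; ring
    rw [h1, integral_const_mul, sub_eq_zero] at h0
    rw [h0, psiLambda, Matrix.smul_apply, smul_eq_mul, hc]
    ring
  rw [← projMatrix_orthogonal]
  calc projMatrix Eᗮ * psiMatrix μ Z Y ψ
      = projMatrix Eᗮ * psiMatrix μ Z Y ψ * (projMatrix E + projMatrix Eᗮ) := by
        rw [projMatrix_orthogonal, add_sub_cancel, mul_one]
    _ = _ := by rw [mul_add, hQP, hQQ, zero_add]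

end PsiMatrix

/-! ### Expectation of a quadratic form -/

section QuadraticForm

variable {p : ℕ}

/-- The quadratic form `D ↦ tr (Q D A D)` on matrices, seen as vectors indexed by pairs. -/
def traceForm (Q A : Matrix (Fin p) (Fin p) ℝ) (x : EuclideanSpace ℝ (Fin p × Fin p)) : ℝ :=
  (Q * vecToMat x * A * vecToMat x).trace

theorem continuous_traceForm (Q A : Matrix (Fin p) (Fin p) ℝ) : Continuous (traceForm Q A) := by
  have := continuous_vecToMat (p := p)
  unfold traceForm
  fun_prop

theorem traceForm_eq_sum (Q A : Matrix (Fin p) (Fin p) ℝ)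
    (x : EuclideanSpace ℝ (Fin p × Fin p)) :
    traceForm Q A x = ∑ a, ∑ d, ∑ c, ∑ b, Q a b * A c d * (x (b, c) * x (d, a)) := by
  simp only [traceForm, Matrix.trace, Matrix.diag, Matrix.mul_apply, vecToMat, Matrix.of_apply,
    Finset.sum_mul]
  exact Finset.sum_congr rfl fun a _ => Finset.sum_congr rfl fun d _ =>
    Finset.sum_congr rfl fun c _ => Finset.sum_congr rfl fun b _ => by ring

variable {Ω : Type*} [MeasurableSpace Ω] {P : Measure Ω}
  {X : Ω → EuclideanSpace ℝ (Fin p × Fin p)}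

theorem integrable_traceForm (hX : MemLp X 2 P) (Q A : Matrix (Fin p) (Fin p) ℝ) :
    Integrable (fun ω => traceForm Q A (X ω)) P := by
  simp only [traceForm_eq_sum]
  exact integrable_finsetSum _ fun a _ => integrable_finsetSum _ fun d _ =>
    integrable_finsetSum _ fun c _ => integrable_finsetSum _ fun b _ =>
      ((memLp_apply hX _).integrable_mul (memLp_apply hX _)).const_mul _

theorem integral_apply_euclidean {ι : Type*} [Fintype ι] {X : Ω → EuclideanSpace ℝ ι}
    (hX : Integrable X P) (i : ι) : (∫ ω, X ω ∂P) i = ∫ ω, X ω i ∂P :=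
  ((EuclideanSpace.proj (𝕜 := ℝ) i).integral_comp_comm hX).symm

theorem integral_traceForm [IsProbabilityMeasure P] (hX : MemLp X 2 P)
    (Q A : Matrix (Fin p) (Fin p) ℝ) :
    ∫ ω, traceForm Q A (X ω) ∂P =
      ∑ a, ∑ d, ∑ c, ∑ b, Q a b * A c d * covMatrix X P (b, c) (d, a) + traceForm Q A P[X] := by
  have hint : ∀ i j, Integrable (fun ω => X ω i * X ω j) P := fun i j =>
    (memLp_apply hX i).integrable_mul (memLp_apply hX j)
  have hcov : ∀ i j, ∫ ω, X ω i * X ω j ∂P = covMatrix X P i j + P[X] i * P[X] j := by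
    intro i j
    rw [covMatrix, Matrix.of_apply, covariance_eq_sub (memLp_apply hX i) (memLp_apply hX j),
      integral_apply_euclidean (hX.integrable (by norm_num)),
      integral_apply_euclidean (hX.integrable (by norm_num))]
    simp
  have h1 : ∀ a d c b, Integrable
      (fun ω => Q a b * A c d * (X ω (b, c) * X ω (d, a))) P := fun a d c b =>
    (hint _ _).const_mul _
  simp only [traceForm_eq_sum]
  rw [integral_finsetSum _ fun a _ => integrable_finsetSum _ fun d _ =>
    integrable_finsetSum _ fun c _ => integrable_finsetSum _ fun b _ => h1 a d c b,
    ← Finset.sum_add_distrib]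
  refine Finset.sum_congr rfl fun a _ => ?_
  rw [integral_finsetSum _ fun d _ =>
    integrable_finsetSum _ fun c _ => integrable_finsetSum _ fun b _ => h1 a d c b,
    ← Finset.sum_add_distrib]
  refine Finset.sum_congr rfl fun d _ => ?_
  rw [integral_finsetSum _ fun c _ => integrable_finsetSum _ fun b _ => h1 a d c b,
    ← Finset.sum_add_distrib]
  refine Finset.sum_congr rfl fun c _ => ?_
  rw [integral_finsetSum _ fun b _ => h1 a d c b, ← Finset.sum_add_distrib]
  refine Finset.sum_congr rfl fun b _ => ?_
  rw [integral_const_mul, hcov]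
  ring

theorem covMatrix_multivariateGaussian {ι : Type*} [Fintype ι] [DecidableEq ι]
    {S : Matrix ι ι ℝ} (hS : S.PosSemidef) :
    covMatrix id (multivariateGaussian 0 S) = S := by
  ext i j
  exact covariance_eval_multivariateGaussian hS i j

/-- The mean of a quadratic form depends only on mean and covariance. Comparing `X` with the centred
Gaussian of the same covariance leaves just the form at the mean of `X`, so no covariance between
matrix entries has to be computed. -/
theorem integral_traceForm_multivariateGaussian [IsProbabilityMeasure P] (hX : MemLp X 2 P)
    (Q A : Matrix (Fin p) (Fin p) ℝ) :
    ∫ x, traceForm Q A x ∂(multivariateGaussian 0 (covMatrix X P)) =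
      ∫ ω, traceForm Q A (X ω) ∂P - traceForm Q A P[X] := by
  have h := integral_traceForm (X := id) (P := multivariateGaussian 0 (covMatrix X P))
    IsGaussian.memLp_two_id Q A
  rw [covMatrix_multivariateGaussian (posSemidef_covMatrix hX)] at h
  rw [integral_traceForm hX, add_sub_cancel_right]
  simp only [id] at h
  rw [h, integral_id_multivariateGaussian]
  simp [traceForm_eq_sum]

theorem covMatrix_congr {Ω' : Type*} [MeasurableSpace Ω'] {P' : Measure Ω'} {ι : Type*} [Fintype ι]
    {X : Ω → EuclideanSpace ℝ ι} {X' : Ω' → EuclideanSpace ℝ ι} (h : IdentDistrib X X' P P') :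
    covMatrix X P = covMatrix X' P' := by
  ext i j
  have hm : ∀ i (ρ : Measure (EuclideanSpace ℝ ι)),
      AEStronglyMeasurable (fun x : EuclideanSpace ℝ ι => x i) ρ := fun i ρ => by fun_prop
  have h1 := covariance_map (hm i (P.map X)) (hm j _) h.aemeasurable_fst
  have h2 := covariance_map (hm i (P'.map X')) (hm j _) h.aemeasurable_snd
  rw [h.map_eq] at h1
  exact h1.symm.trans h2

end QuadraticForm

/-! ### Delta method for the Riesz projection -/

section Delta

variable {Ω : Type*} [MeasurableSpace Ω] {μ : Measure Ω} [IsProbabilityMeasure μ]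
  {Ω' : Type*} [MeasurableSpace Ω'] {ν : Measure Ω'} [IsProbabilityMeasure ν]

/-- Portmanteau for the closed set `[ε, ∞)`, which has no mass under the point mass at zero. -/
theorem TendstoInDistribution.tendsto_measure_of_zero {X : ℕ → Ω → ℝ}
    (h : TendstoInDistribution X atTop (fun _ : Ω' => (0 : ℝ)) (fun _ => μ) ν) {ε : ℝ}
    (hε : 0 < ε) : Tendsto (fun n => μ {ω | ε ≤ X n ω}) atTop (𝓝 0) := by
  have hF : IsClosed (Set.Ici ε) := isClosed_Ici
  have := ProbabilityMeasure.limsup_measure_closed_le_of_tendsto h.tendsto hF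
  simp only [ProbabilityMeasure.coe_mk] at this
  rw [Measure.map_apply (by fun_prop) hF.measurableSet] at this
  have h0 : (fun _ : Ω' => (0 : ℝ)) ⁻¹' Set.Ici ε = ∅ := by
    ext; simp [hε]
  rw [h0, measure_empty] at this
  have h1 : ∀ n, (μ.map (X n)) (Set.Ici ε) = μ {ω | ε ≤ X n ω} := fun n => by
    rw [Measure.map_apply_of_aemeasurable (h.forall_aemeasurable n) hF.measurableSet]
    rfl
  simp only [h1] at this
  exact tendsto_of_le_liminf_of_limsup_le bot_le this

open scoped Matrix.Norms.Operator in
-- Second order delta method: the linear term is absent, so the rate is `n`. The leading term is a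
-- continuous function of `G n`, and the remainder tends to zero in measure.
theorem tendstoInDistribution_mul_trace_rieszProj {p : ℕ} {a : ℂ} {γ : Path a a}
    {M P Q A : Matrix (Fin p) (Fin p) ℝ} {lam : ℝ} (hM : M.IsHermitian)
    (hγ : EnclosesEigenvaluesExcept γ M lam)
    (hQM : Q * M = lam • Q) (hMQ : M * Q = lam • Q)
    (hNP : (M - lam • 1) * P = M - lam • 1) (hPA : P * A = A)
    (hNA : (M - lam • 1) * (M - lam • 1) * A = P)
    {G : ℕ → Ω → EuclideanSpace ℝ (Fin p × Fin p)} {G' : Ω' → EuclideanSpace ℝ (Fin p × Fin p)}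
    (hG : TendstoInDistribution G atTop G' (fun _ => μ) ν)
    {X : ℕ → Ω → Matrix (Fin p) (Fin p) ℝ}
    (hX : ∀ n ω, n ≠ 0 → X n ω = M + (√(n : ℝ))⁻¹ • vecToMat (G n ω))
    (hmeas : ∀ n : ℕ, AEMeasurable
      (fun ω => (n : ℂ) * (Q.map Complex.ofReal * rieszProj γ (X n ω)).trace) μ) :
    TendstoInDistribution
      (fun (n : ℕ) ω => (n : ℂ) * (Q.map Complex.ofReal * rieszProj γ (X n ω)).trace)
      atTop (fun ω => (traceForm Q A (G' ω) : ℂ)) (fun _ => μ) ν := by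
  obtain ⟨K, δ, hδ, hK⟩ := exists_norm_trace_mul_rieszProj_sub_le hM hγ hQM hMQ hNP hPA hNA
  have hlim := hG.continuous_comp (g := fun x => (traceForm Q A x : ℂ))
    (Complex.continuous_ofReal.comp (continuous_traceForm Q A))
  refine tendstoInDistribution_of_tendstoInMeasure_sub _ _ hlim ?_ hmeas
  -- With `s = n^{-1/2}` and `g = ‖G n‖`, the single quantity `s (g + g³)` dominates both `s g`,
  -- which must be at most `δ` for the expansion, and `s g³`, the size of the scaled remainder. It
  -- tends to zero in law by Slutsky.
  set H : EuclideanSpace ℝ (Fin p × Fin p) × ℝ → ℝ := fun x =>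
    x.2 * (‖(vecToMat x.1).map Complex.ofReal‖ + ‖(vecToMat x.1).map Complex.ofReal‖ ^ 3) with hH
  have hHc : Continuous H := by
    have h1 : Continuous fun x : EuclideanSpace ℝ (Fin p × Fin p) × ℝ =>
        (vecToMat x.1).map Complex.ofReal :=
      (continuous_vecToMat.comp continuous_fst).matrix_map Complex.continuous_ofReal
    have h2 := continuous_norm.comp h1
    exact continuous_snd.mul (h2.add (h2.pow 3))
  have hsq : Tendsto (fun n : ℕ => (√(n : ℝ))⁻¹) atTop (𝓝 0) :=
    tendsto_inv_atTop_zero.comp (Real.tendsto_sqrt_atTop.comp tendsto_natCast_atTop_atTop)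
  have hconst : TendstoInMeasure μ (fun (n : ℕ) (_ : Ω) => (√(n : ℝ))⁻¹) atTop fun _ => 0 :=
    tendstoInMeasure_of_tendsto_ae (fun _ => aestronglyMeasurable_const) (ae_of_all _ fun _ => hsq)
  have hH0 := hG.continuous_comp_prodMk_of_tendstoInMeasure_const hHc hconst
    fun _ => aemeasurable_const
  have hH1 : (fun ω => H (G' ω, 0)) = fun _ => 0 := by
    ext ω; simp [hH]
  rw [hH1] at hH0
  rw [tendstoInMeasure_iff_norm]
  intro ε hε
  -- Below this threshold the expansion is valid and the error is less than `ε`; `|K| + 1` is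
  -- positive whatever the sign of `K`.
  have hη : 0 < min δ (ε / (|K| + 1)) := lt_min hδ (by positivity)
  refine tendsto_of_tendsto_of_tendsto_of_le_of_le' tendsto_const_nhds
    (TendstoInDistribution.tendsto_measure_of_zero hH0 hη) (Eventually.of_forall fun _ => zero_le)
    ?_
  filter_upwards [eventually_ne_atTop 0] with n hn
  refine measure_mono fun ω hω => ?_
  simp only [Set.mem_ofPred_eq] at hω ⊢
  by_contra hlt
  rw [not_le] at hlt
  obtain ⟨hlt1, hlt2⟩ := lt_min_iff.1 hlt
  have hn0 : (0 : ℝ) < n := by exact_mod_cast Nat.pos_of_ne_zero hn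
  set s := (√(n : ℝ))⁻¹ with hs
  have hs0 : 0 < s := by positivity
  have hns : (n : ℝ) * s ^ 2 = 1 := by
    rw [hs, inv_pow, Real.sq_sqrt hn0.le, mul_inv_cancel₀ hn0.ne']
  set g := ‖(vecToMat (G n ω)).map Complex.ofReal‖ with hg
  have hg0 : 0 ≤ g := norm_nonneg _
  have hHval : H (G n ω, s) = s * (g + g ^ 3) := rfl
  rw [hHval] at hlt1 hlt2
  have hD : ‖(s • vecToMat (G n ω)).map Complex.ofReal‖ = s * g := by
    rw [map_ofReal_smul, norm_smul, Complex.norm_real, Real.norm_of_nonneg hs0.le]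
  have hb := hK (s • vecToMat (G n ω)) (by
    rw [hD]
    have : 0 ≤ s * g ^ 3 := by positivity
    linarith [mul_add s g (g ^ 3)])
  rw [hD, ← hX n ω hn] at hb
  have htr : ((Q * s • vecToMat (G n ω) * A * s • vecToMat (G n ω)).trace : ℝ) =
      s ^ 2 * traceForm Q A (G n ω) := by
    simp only [traceForm, Matrix.mul_smul, Matrix.smul_mul, Matrix.trace_smul, smul_eq_mul]
    ring
  rw [htr] at hb
  have hkey : (n : ℂ) * (Q.map Complex.ofReal * rieszProj γ (X n ω)).trace -
      (traceForm Q A (G n ω) : ℂ) = (n : ℂ) *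
      ((Q.map Complex.ofReal * rieszProj γ (X n ω)).trace -
        ((s ^ 2 * traceForm Q A (G n ω) : ℝ) : ℂ)) := by
    have : (n : ℂ) * (s : ℂ) ^ 2 = 1 := by exact_mod_cast hns
    push_cast
    rw [mul_sub, ← mul_assoc, this, one_mul]
  have hω' : ε ≤ n * (K * (s * g) ^ 3) := by
    refine hω.trans ?_
    simp only [Pi.sub_apply, Pi.zero_apply, sub_zero, Function.comp_apply]
    rw [hkey, norm_mul, Complex.norm_natCast]
    exact mul_le_mul_of_nonneg_left hb hn0.le
  have h1 : (n : ℝ) * (K * (s * g) ^ 3) = K * (s * g ^ 3) := by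
    calc _ = (n * s ^ 2) * (K * (s * g ^ 3)) := by ring
      _ = _ := by rw [hns, one_mul]
  rw [h1] at hω'
  have h2 : s * (g + g ^ 3) * (|K| + 1) < ε := (lt_div_iff₀ (by positivity)).1 hlt2
  have h3 : K * (s * g ^ 3) ≤ |K| * (s * g ^ 3) :=
    mul_le_mul_of_nonneg_right (le_abs_self K) (by positivity)
  have h4 : 0 ≤ s * g * (|K| + 1) := by positivity
  have h5 : 0 ≤ s * g ^ 3 := by positivity
  nlinarith

end Delta

/-! ### The sample of matrices `Z Zᵀ ψ(Y)` -/

section Sample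

variable {p : ℕ}

/-- The matrix `z zᵀ ψ(y)` as a vector indexed by pairs. -/
def outerVec (ψ : ℝ → ℝ) (x : EuclideanSpace ℝ (Fin p) × ℝ) : EuclideanSpace ℝ (Fin p × Fin p) :=
  WithLp.toLp 2 fun q => x.1 q.1 * x.1 q.2 * ψ x.2

theorem measurable_outerVec {ψ : ℝ → ℝ} (hψ : Measurable ψ) :
    Measurable (outerVec (p := p) ψ) := by
  unfold outerVec
  fun_prop

theorem norm_starProjection_sq (E : Submodule ℝ (EuclideanSpace ℝ (Fin p)))
    (z : EuclideanSpace ℝ (Fin p)) :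
    ‖E.starProjection z‖ ^ 2 = ∑ i, ∑ j, projMatrix E i j * z i * z j := by
  rw [← real_inner_self_eq_norm_sq, Submodule.inner_starProjection_left_eq_right,
    Submodule.starProjection_eq_self_iff.2 (E.starProjection_apply_mem z), PiLp.inner_apply]
  refine Finset.sum_congr rfl fun i _ => ?_
  simp only [RCLike.inner_apply, conj_trivial, starProjection_apply_eq_sum, Finset.sum_mul]
  exact Finset.sum_congr rfl fun j _ => by ring

/-- For `D = z zᵀ ψ(y)` the trace factors as `ψ(y)² (zᵀ P_E z)(zᵀ A z)`, and `zᵀ P_E z = ‖P_E z‖²`.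
-/
theorem traceForm_outerVec (E : Submodule ℝ (EuclideanSpace ℝ (Fin p)))
    (A : Matrix (Fin p) (Fin p) ℝ) (ψ : ℝ → ℝ) (z : EuclideanSpace ℝ (Fin p)) (y : ℝ) :
    traceForm (projMatrix E) A (outerVec ψ (z, y)) =
      ∑ i, ∑ j, (z i * z j * ‖E.starProjection z‖ ^ 2 * ψ y ^ 2) * A j i := by
  have h : ∑ i, ∑ j, (z i * z j * ‖E.starProjection z‖ ^ 2 * ψ y ^ 2) * A j i =
      ‖E.starProjection z‖ ^ 2 * ∑ d, ∑ c, z d * z c * ψ y ^ 2 * A c d := by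
    simp only [Finset.mul_sum]
    exact Finset.sum_congr rfl fun d _ => Finset.sum_congr rfl fun c _ => by ring
  rw [h, traceForm_eq_sum, norm_starProjection_sq, Finset.sum_mul]
  refine Finset.sum_congr rfl fun a _ => ?_
  simp only [outerVec, Finset.sum_mul]
  simp only [Finset.mul_sum]
  rw [Finset.sum_comm]
  conv_rhs => rw [Finset.sum_comm]
  conv_lhs => rw [Finset.sum_comm]
  refine Finset.sum_congr rfl fun d _ => ?_
  conv_rhs => rw [Finset.sum_comm]
  exact Finset.sum_congr rfl fun c _ => Finset.sum_congr rfl fun b _ => by ring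

variable {Ω : Type*} [MeasurableSpace Ω] {μ : Measure Ω}
  {Z : Ω → EuclideanSpace ℝ (Fin p)} {Y : Ω → ℝ} {ψ : ℝ → ℝ}

theorem memLp_outerVec (hZ : Measurable Z) (hY : Measurable Y) (hψ : Measurable ψ)
    (hmom : MemLp (fun ω => ‖Z ω‖ ^ 2 * ψ (Y ω)) 2 μ) :
    MemLp (fun ω => outerVec ψ (Z ω, Y ω)) 2 μ :=
  memLp_piLp_iff.2 fun q => memLp_mul_mul hZ hY hψ hmom q.1 q.2

theorem vecToMat_integral_outerVec [IsProbabilityMeasure μ] (hZ : Measurable Z)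
    (hY : Measurable Y) (hψ : Measurable ψ)
    (hmom : MemLp (fun ω => ‖Z ω‖ ^ 2 * ψ (Y ω)) 2 μ) :
    vecToMat (∫ ω, outerVec ψ (Z ω, Y ω) ∂μ) = psiMatrix μ Z Y ψ := by
  ext i j
  rw [vecToMat, Matrix.of_apply, integral_apply_euclidean
    ((memLp_outerVec hZ hY hψ hmom).integrable (by norm_num))]
  rfl

theorem integral_traceForm_outerVec (hZ : Measurable Z) (hY : Measurable Y) (hψ : Measurable ψ)
    (hmom : MemLp (fun ω => ‖Z ω‖ ^ 2 * ψ (Y ω)) 2 μ)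
    (E : Submodule ℝ (EuclideanSpace ℝ (Fin p))) (A : Matrix (Fin p) (Fin p) ℝ) :
    ∫ ω, traceForm (projMatrix Eᗮ) A (outerVec ψ (Z ω, Y ω)) ∂μ =
      (psiFourthMatrix μ Z Y ψ E * A).trace := by
  have hint : ∀ i j, Integrable
      (fun ω => Z ω i * Z ω j * ‖Eᗮ.starProjection (Z ω)‖ ^ 2 * ψ (Y ω) ^ 2) μ := by
    intro i j
    refine hmom.integrable_sq.mono' (by fun_prop) (ae_of_all _ fun ω => ?_)
    rw [norm_mul, norm_mul, norm_mul, norm_pow, norm_pow, norm_norm]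
    calc ‖Z ω i‖ * ‖Z ω j‖ * ‖Eᗮ.starProjection (Z ω)‖ ^ 2 * ‖ψ (Y ω)‖ ^ 2
        ≤ ‖Z ω‖ * ‖Z ω‖ * ‖Z ω‖ ^ 2 * ‖ψ (Y ω)‖ ^ 2 := by
          gcongr
          · exact PiLp.norm_apply_le _ _
          · exact PiLp.norm_apply_le _ _
          · exact Submodule.norm_starProjection_apply_le _ _
      _ = _ := by rw [Real.norm_eq_abs, sq_abs]; ring
  simp only [traceForm_outerVec]
  rw [integral_finsetSum _ fun i _ => integrable_finsetSum _ fun j _ => (hint i j).mul_const _]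
  simp only [Matrix.trace, Matrix.diag, Matrix.mul_apply]
  refine Finset.sum_congr rfl fun i _ => ?_
  rw [integral_finsetSum _ fun j _ => (hint i j).mul_const _]
  refine Finset.sum_congr rfl fun j _ => ?_
  rw [integral_mul_const, psiFourthMatrix, Matrix.of_apply]

theorem empPsiMatrix_eq_vecToMat {Ω : Type*} (Zs : ℕ → Ω → EuclideanSpace ℝ (Fin p)) (Ys : ℕ → Ω → ℝ)
    (ψ : ℝ → ℝ) (n : ℕ) (ω : Ω) :
    empPsiMatrix Zs Ys ψ n ω =
      vecToMat ((n : ℝ)⁻¹ • ∑ k ∈ Finset.range n, outerVec ψ (Zs k ω, Ys k ω)) := by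
  ext i j
  simp [empPsiMatrix, vecToMat, outerVec]

/-- Displays an empirical mean as its expectation plus `n^{-1/2}` times the standardised sum. At `n
= 0` the left side is zero by the convention `0⁻¹ = 0`, so that case is excluded. -/
theorem vecToMat_inv_smul_sum (n : ℕ) (hn : n ≠ 0) (m : EuclideanSpace ℝ (Fin p × Fin p))
    (S : EuclideanSpace ℝ (Fin p × Fin p)) :
    vecToMat ((n : ℝ)⁻¹ • S) =
      vecToMat m + (√(n : ℝ))⁻¹ • vecToMat ((√(n : ℝ))⁻¹ • (S - (n : ℝ) • m)) := by
  have hn0 : (n : ℝ) ≠ 0 := by exact_mod_cast hn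
  rw [← vecToMat_smul, ← vecToMat_add, smul_smul, ← mul_inv, Real.mul_self_sqrt n.cast_nonneg,
    smul_sub, smul_smul, inv_mul_cancel₀ hn0, one_smul, add_sub_cancel]

theorem aemeasurable_trace_rieszProj {a : ℂ} (γ : Path a a) (Q : Matrix (Fin p) (Fin p) ℂ)
    {V : Ω → EuclideanSpace ℝ (Fin p × Fin p)} (hV : AEMeasurable V μ) :
    AEMeasurable (fun ω => (Q * rieszProj γ (vecToMat (V ω))).trace) μ := by
  simp only [Matrix.trace, Matrix.diag, Matrix.mul_apply]
  exact Finset.aemeasurable_fun_sum _ fun i _ => Finset.aemeasurable_fun_sum _ fun j _ =>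
    ((measurable_rieszProj_vecToMat γ j i).comp_aemeasurable hV).const_mul _

/-- Convergence in law sees only the law of the limit, so the limit may be realised as the identity
on `ℝ`; this is how a measure on `ℝ` common to all contours can serve as the limit. -/
theorem TendstoInDistribution.of_map {Ω' : Type*} [MeasurableSpace Ω'] {ν : Measure Ω'}
    [IsProbabilityMeasure μ] [IsProbabilityMeasure ν] {X : ℕ → Ω → ℂ} {W : Ω' → ℝ}
    (hW : AEMeasurable W ν) [IsProbabilityMeasure (ν.map W)]
    (h : TendstoInDistribution X atTop (fun ω => (W ω : ℂ)) (fun _ => μ) ν) :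
    TendstoInDistribution X atTop (fun w : ℝ => (w : ℂ)) (fun _ => μ) (ν.map W) where
  forall_aemeasurable := h.forall_aemeasurable
  aemeasurable_limit := Complex.measurable_ofReal.aemeasurable
  tendsto := by
    convert! h.tendsto using 1
    refine congrArg 𝓝 (Subtype.ext ?_)
    exact AEMeasurable.map_map_of_aemeasurable Complex.measurable_ofReal.aemeasurable hW

end Sample

end

/-! ### Limit law and its mean -/

theorem mainTheorem9 {Ω : Type*} [MeasurableSpace Ω] (μ : Measure Ω) [IsProbabilityMeasure μ]
    {p : ℕ}
    (Z : Ω → EuclideanSpace ℝ (Fin p)) (Y : Ω → ℝ) (hZ : Measurable Z) (hY : Measurable Y)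
    (Zs : ℕ → Ω → EuclideanSpace ℝ (Fin p)) (Ys : ℕ → Ω → ℝ)
    -- the sample consists of independent copies of the pair (Z, Y)
    (hindep : iIndepFun (fun i ω => (Zs i ω, Ys i ω)) μ)
    (hident : ∀ i, IdentDistrib (fun ω => (Zs i ω, Ys i ω)) (fun ω => (Z ω, Y ω)) μ μ)
    (Ec : Submodule ℝ (EuclideanSpace ℝ (Fin p))) (hEc : IsCentralSubspace μ Z Y Ec)
    (hd : Module.finrank ℝ Ec < p)
    (hZ2 : MemLp Z 2 μ)
    (hlin : LinearityCondition μ Z Ec) (hdcv : DiagonalCondVar μ Z Ec)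
    (ψ : ℝ → ℝ) (hψ : Measurable ψ)
    -- the entries of Z Zᵀ ψ(Y) are square integrable
    (hmom : MemLp (fun ω => ‖Z ω‖ ^ 2 * ψ (Y ω)) 2 μ)
    (hcover : psiSpace μ Z Y ψ Ec = Ec) :
    ∃ (ν : Measure ℝ) (_ : IsProbabilityMeasure ν),
      -- for every admissible contour, `ν` is the limit law of `n tr(Q_c P̂_n)`
      (∀ (a : ℂ) (γ : Path a a),
        EnclosesEigenvaluesExcept γ (psiMatrix μ Z Y ψ) (psiLambda μ Z Y ψ Ec) →
        TendstoInDistribution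
          (fun (n : ℕ) (ω : Ω) => (n : ℂ) *
            ((1 - projMatrix Ec).map Complex.ofReal *
              rieszProj γ (empPsiMatrix Zs Ys ψ n ω)).trace)
          atTop (fun w : ℝ => (w : ℂ)) (fun _ => μ) ν) ∧
      Integrable (fun w : ℝ => w) ν ∧
      ∫ w, w ∂ν =
        (psiFourthMatrix μ Z Y ψ Ec * projMatrix Ec *
          (invOnRange (projMatrix Ec)
            (projMatrix Ec * psiMatrix μ Z Y ψ - psiLambda μ Z Y ψ Ec • 1)) ^ 2).trace ∧
      (psiLambda μ Z Y ψ Ec ≠ 0 →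
        IsUnit (projMatrix Ec * psiMatrix μ Z Y ψ - psiLambda μ Z Y ψ Ec • 1) ∧
        ∫ w, w ∂ν =
          (psiFourthMatrix μ Z Y ψ Ec * projMatrix Ec *
            ((projMatrix Ec * psiMatrix μ Z Y ψ - psiLambda μ Z Y ψ Ec • 1)⁻¹) ^ 2).trace) := by
  have hM := transpose_psiMatrix (μ := μ) (Z := Z) (Y := Y) (ψ := ψ)
  have hQM := one_sub_projMatrix_mul_psiMatrix hEc.1 hd hZ hY hZ2 hlin hdcv hψ hmom
  rw [psiSpace] at hcover
  set M := psiMatrix μ Z Y ψ with hMdef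
  set lam := psiLambda μ Z Y ψ Ec with hlam
  set A := sqInvOnRange Ec M lam with hA
  set Q := projMatrix Ecᗮ with hQ
  have hQ' : 1 - projMatrix Ec = Q := (projMatrix_orthogonal Ec).symm
  have hMQ := mul_one_sub_projMatrix hM hQM
  set V : Ω → EuclideanSpace ℝ (Fin p × Fin p) := fun ω => outerVec ψ (Z ω, Y ω) with hV
  have hVL : MemLp V 2 μ := memLp_outerVec hZ hY hψ hmom
  have hΦ := measurable_outerVec (p := p) hψ
  set X : ℕ → Ω → EuclideanSpace ℝ (Fin p × Fin p) :=
    fun k ω => outerVec ψ (Zs k ω, Ys k ω) with hX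
  have hXV : ∀ k, IdentDistrib (X k) V μ μ := fun k => (hident k).comp hΦ
  have hXL : MemLp (X 0) 2 μ := (hXV 0).memLp_iff.2 hVL
  have hcov : covMatrix (X 0) μ = covMatrix V μ := covMatrix_congr (hXV 0)
  have hmeanV : vecToMat μ[V] = M := vecToMat_integral_outerVec hZ hY hψ hmom
  have hmeanX : vecToMat μ[X 0] = M := by rw [(hXV 0).integral_eq, hmeanV]
  have hclt := tendstoInDistribution_inv_sqrt_smul_sum_sub hXL (hindep.comp _ fun _ => hΦ)
    fun k => (hXV k).trans (hXV 0).symm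
  rw [hcov] at hclt
  set ν := multivariateGaussian 0 (covMatrix V μ) with hν
  have hWm : AEMeasurable (traceForm Q A) ν :=
    (continuous_traceForm Q A).measurable.aemeasurable
  have hprob : IsProbabilityMeasure (ν.map (traceForm Q A)) :=
    Measure.isProbabilityMeasure_map hWm
  have hid : AEStronglyMeasurable (fun w : ℝ => w) (ν.map (traceForm Q A)) := by fun_prop
  have hmean : ∫ w, w ∂(ν.map (traceForm Q A)) = (psiFourthMatrix μ Z Y ψ Ec * A).trace := by
    rw [integral_map hWm hid, integral_traceForm_multivariateGaussian hVL,
      integral_traceForm_outerVec hZ hY hψ hmom]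
    -- The correction for the mean is `tr(Q M A M) = lam tr(Q A M)`, and `Q A = 0` because `A = P
    -- A`.
    have h0 : traceForm Q A μ[V] = 0 := by
      have hQA : Q * A = 0 := by
        rw [← hQ', hA, ← projMatrix_mul_sqInvOnRange, ← mul_assoc, sub_mul, one_mul,
          projMatrix_mul_self, sub_self, zero_mul]
      rw [traceForm, hmeanV, ← hQ', hQM, hQ', Matrix.smul_mul, hQA]
      simp
    rw [h0, sub_zero]
  -- The limit law is built from the covariance of `V`, `Q` and `A` before any contour is
  -- introduced, hence is the same for all of them.
  refine ⟨ν.map (traceForm Q A), hprob, fun a γ hγ => ?_, ?_, ?_, fun hlam0 => ?_⟩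
  · rw [hQ'] at hQM hMQ ⊢
    refine TendstoInDistribution.of_map hWm ?_
    refine tendstoInDistribution_mul_trace_rieszProj (by simpa [Matrix.IsSymm] using hM) hγ hQM hMQ
      (sub_smul_one_mul_projMatrix hM (by rwa [hQ'])) projMatrix_mul_sqInvOnRange
      (sub_smul_one_sq_mul_sqInvOnRange hM (by rwa [hQ']) hcover) hclt ?_ fun n => ?_
    · intro n ω hn
      rw [empPsiMatrix_eq_vecToMat, vecToMat_inv_smul_sum n hn μ[X 0], hmeanX]
    · simp only [empPsiMatrix_eq_vecToMat]
      have := fun k => (hXV k).aemeasurable_fst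
      exact (aemeasurable_trace_rieszProj γ _ ((Finset.aemeasurable_fun_sum _ fun k _ =>
        this k).fun_const_smul _)).const_mul _
  · rw [integrable_map_measure hid hWm]
    exact integrable_traceForm (X := id) IsGaussian.memLp_two_id Q A
  · rw [hmean, hA, sqInvOnRange, mul_assoc]
  · obtain ⟨h1, h2⟩ := isUnit_and_projMatrix_mul_inv_sq hM hQM hcover hlam0
    exact ⟨h1, by rw [hmean, hA, ← h2, mul_assoc]⟩
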